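/- Throughout, posets are finite. Let $\mathbf{X}$ be the poset on five elements $a,b,c,d,e$ whose order is generated by $a<c$, $b<c$, $c<d$, $c<e$ (so $a,b$ are incomparable and $d,e$ are incomparable). A poset is called $X$-free if none of its induced subposets is isomorphic to $\mathbf{X}$. Let $\mathcal{F}$ be the smallest class of posets that contains all $X$-free posets and is closed under isomorphism, disjoint unions and ordinal sums. For a poset $P$, the order polytope and the chain polytope are $$\mathcal{O}(P)=\{x\in\mathbb{R}^P : 0\le x_p\le 1 \text{ for all } p\in P,\ x_p\le x_q \text{ if } p\le q\},$$ $$\mathcal{C}(P)=\{x\in\mathbb{R}^P : x_p\ge 0 \text{ for all } p\in P,\ x_{p_1}+\cdots+x_{p_k}\le 1 \text{ if } p_1<\cdots<p_k \text{ in } P\}.$$ For a polytope $\mathcal{P}$ and an integer $k\ge -1$, let $s_k(\mathcal{P})$ be the number of $k$-dimensional faces of $\mathcal{P}$ that are simplices, where $\emptyset$ and $\mathcal{P}$ count as faces of $\mathcal{P}$, and $\emptyset$ is a simplex of dimension $-1$. Set $$S_{\mathcal{P}}(x)=\sum_{i=-1}^{\dim\mathcal{P}} s_i(\mathcal{P})\,x^{i+1}\in\mathbb{Z}_{\ge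 0}[x].$$ Let $P$ be a poset in $\mathcal{F}$. Then $S_{\mathcal{O}(P)}(x)=S_{\mathcal{C}(P)}(x)$ if and only if $P$ is $X$-free. -/

import Mathlib

open scoped Polynomial

universe u

/-- The poset `X` with five elements: two incomparable elements, all below a single middle
element, which is below two incomparable elements (`⊕` is the disjoint union of posets and
`A ⊕ₗ B` the ordinal sum, with every element of `A` below every element of `B`). -/
abbrev PosetX : Type := (Unit ⊕ Unit) ⊕ₗ Unit ⊕ₗ (Unit ⊕ Unit)

/-- `P` is `X`-free: it contains no copy of `X` as a subposet (with the induced order). -/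
def XFree (P : Type u) [PartialOrder P] : Prop :=
  IsEmpty (PosetX ↪o P)

/-- The family of finite posets built from finite `X`-free posets using disjoint unions and ordinal
sums (closed under isomorphism of posets). -/
inductive InFamilyF : ∀ (P : Type u) [PartialOrder P], Prop
  | xFree (P : Type u) [PartialOrder P] [Finite P] : XFree P → InFamilyF P
  | disjointUnion (A B : Type u) [PartialOrder A] [PartialOrder B] :
      InFamilyF A → InFamilyF B → InFamilyF (A ⊕ B)
  | ordinalSum (A B : Type u) [PartialOrder A] [PartialOrder B] :
      InFamilyF A → InFamilyF B → InFamilyF (A ⊕ₗ B)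
  | orderIso (A B : Type u) [PartialOrder A] [PartialOrder B] :
      (A ≃o B) → InFamilyF A → InFamilyF B

/-- The order polytope of `P`, in `ℝ^P`. -/
def orderPolytope (P : Type u) [PartialOrder P] : Set (P → ℝ) :=
  {x | (∀ p, 0 ≤ x p ∧ x p ≤ 1) ∧ ∀ p q, p ≤ q → x p ≤ x q}

/-- The chain polytope of `P`, in `ℝ^P`. -/
def chainPolytope (P : Type u) [PartialOrder P] : Set (P → ℝ) :=
  {x | (∀ p, 0 ≤ x p) ∧
    ∀ c : Finset P, IsChain (· ≤ ·) (c : Set P) → ∑ p ∈ c, x p ≤ 1}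

section Polytope

variable {E : Type u} [AddCommGroup E] [Module ℝ E]

/-- The affine dimension of a set, with the convention that `∅` has dimension `-1`. -/
noncomputable def affDim (F : Set E) : ℤ :=
  open Classical in if F = ∅ then -1 else (Module.finrank ℝ (vectorSpan ℝ F) : ℤ)

/-- A simplex: the convex hull of a finite affinely independent set. The empty set is a simplex. -/
def IsSimplex (F : Set E) : Prop :=
  ∃ V : Finset E, AffineIndependent ℝ ((↑) : V → E) ∧ F = convexHull ℝ (V : Set E)

variable [TopologicalSpace E]

/-- `F` is a simplex face of the polytope `K`. For a polytope in `ℝ^n`, Mathlib's `IsExposed ℝ K F`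
(`F` is empty, or the set of points of `K` that maximize some linear functional) says that `F` is a
face; both `∅` and `K` are faces. -/
def IsSimplexFace (K F : Set E) : Prop :=
  IsExposed ℝ K F ∧ IsSimplex F

/-- `s_k(K)`: the number of `k`-dimensional simplex faces of the polytope `K` (a polytope has only
finitely many faces). -/
noncomputable def numSimplexFaces (K : Set E) (k : ℤ) : ℕ :=
  Set.ncard {F : Set E | IsSimplexFace K F ∧ affDim F = k}

/-- The simplex-counting polynomial `S_K(x) = ∑_{i = -1}^{dim K} s_i(K) x^{i + 1}`. -/
noncomputable def simplexPoly (K : Set E) : ℕ[X] :=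
  ∑ j ∈ Finset.range (affDim K + 2).toNat,
    Polynomial.C (numSimplexFaces K ((j : ℤ) - 1)) * Polynomial.X ^ j

end Polytope

/-!
# Simplex faces of order and chain polytopes

If `P` is `X`-free, then for every `p` the elements below `p` or the elements above `p` form a
chain, and an explicit affine equivalence (`chainToOrder`) maps the chain polytope onto the order
polytope; hence the simplex-counting polynomials agree.

For the converse the polynomials are evaluated at `1`, which gives the total number of simplex
faces (`eval_one_simplexPoly`). Both polytopes are convex hulls of 0/1-vectors, the indicators of
filters and of antichains, and a simplex face is determined by its vertex set. So everything reduces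
to counting `simplexFaceSets V`: the affinely independent subsets of a finite set `V` which some
affine function, nonnegative on `V`, cuts out of `V`.

Write `σ` for this number, and `Y` and `N` for the numbers of simplex faces through and avoiding a
chosen vertex. A disjoint union of posets gives products of polytopes, where a nonempty simplex
face is the product of a simplex face and a vertex; so the count is increasing in the counts of the
factors (`ncard_simplexFaceSets_prod`), and the numbers of vertices of the two polytopes are equal
(`ncard_filterVectors_eq`). An ordinal sum gives a wedge of two polytopes at a common vertex: the
order polytopes are glued at the empty filter of the lower part and the full filter of the upper
part, the chain polytopes at the origins. For a wedge (`ncard_simplexFaceSets_wedge`)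
`σ = Y_A Y_B + N_A N_B = (σ_A σ_B + (N_A - Y_A) (N_B - Y_B)) / 2`, where `N - Y = σ - 2 Y ≥ 0`
because deleting the chosen vertex from a simplex face leaves a simplex face. For the chain polytope
`Y` is at most the number of chains of `P`, and for the order polytope it is at least this number,
since a chain of principal filters spans a simplex face with the empty filter. Thus by induction
the order polytope has at most as many simplex faces as the chain polytope
(`InFamilyF.ncard_simplexFaceSets_le`).

The inequality becomes strict when a copy of `X` first appears. It is then cut by an ordinal sum
directly below or above its middle element, so that one summand contains two incomparable elements,
whence `N > Y` for its chain polytope, and the other contains two incomparable elements with a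
common bound, whence `Y` for its order polytope exceeds the number of chains.
-/

/-! ### Affine functions on finite point sets -/

section Faces

variable {E F : Type*} [AddCommGroup E] [Module ℝ E] [AddCommGroup F] [Module ℝ F]

theorem AffineMap.map_add_sub_real (f : E →ᵃ[ℝ] ℝ) (x y z : E) :
    f (x + y - z) = f x + f y - f z := by
  rw [f.decomp]
  simp only [Pi.add_apply, map_sub, map_add]
  ring

theorem AffineMap.exists_eq_sum {ι : Type*} (s : Finset ι) (f : ι → E →ᵃ[ℝ] ℝ) :
    ∃ g : E →ᵃ[ℝ] ℝ, ∀ x, g x = ∑ i ∈ s, f i x := by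
  classical
  induction s using Finset.induction_on with
  | empty => exact ⟨0, fun x => by simp⟩
  | insert a s ha ih =>
    obtain ⟨g, hg⟩ := ih
    exact ⟨f a + g, fun x => by rw [Finset.sum_insert ha, ← hg]; rfl⟩

/-- A set `T` of points on which every real function is the restriction of an affine one. For
finite `T` this is affine independence, in the form in which it is easiest to verify and use. -/
def AffinelyInterpolating (T : Set E) : Prop :=
  ∀ g : E → ℝ, ∃ f : E →ᵃ[ℝ] ℝ, ∀ t ∈ T, f t = g t

/-- `T` is the set of points of `V` on a common face of the convex hull of `V`: some affine function
is nonnegative on `V` with zero set `T` in `V`. The empty set qualifies, by a positive constant. -/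
def CutsOutFace (V T : Set E) : Prop :=
  T ⊆ V ∧ ∃ f : E →ᵃ[ℝ] ℝ, ∀ v ∈ V, 0 ≤ f v ∧ (f v = 0 ↔ v ∈ T)

/-- The vertex sets of the simplex faces of the convex hull of `V`. -/
def simplexFaceSets (V : Set E) : Set (Set E) :=
  {T | CutsOutFace V T ∧ AffinelyInterpolating T}

/-- All points of `V` are vertices of its convex hull. -/
def InConvexPosition (V : Set E) : Prop :=
  ∀ v ∈ V, CutsOutFace V {v}

theorem AffinelyInterpolating.mono {S T : Set E} (hT : AffinelyInterpolating T) (h : S ⊆ T) :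
    AffinelyInterpolating S := fun g =>
  (hT g).imp fun _ hf t ht => hf t (h ht)

theorem affinelyInterpolating_singleton (v : E) : AffinelyInterpolating ({v} : Set E) := fun g =>
  ⟨AffineMap.const ℝ E (g v), by simp⟩

theorem affinelyInterpolating_empty : AffinelyInterpolating (∅ : Set E) := fun _ =>
  ⟨0, by simp⟩

theorem AffinelyInterpolating.insert {T : Set E} (hT : AffinelyInterpolating T) {p : E}
    (h : ∃ f : E →ᵃ[ℝ] ℝ, (∀ t ∈ T, f t = 0) ∧ f p ≠ 0) :
    AffinelyInterpolating (insert p T) := by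
  intro g
  obtain ⟨f, hf, hp⟩ := h
  obtain ⟨k, hk⟩ := hT g
  refine ⟨k + ((g p - k p) / f p) • f, ?_⟩
  rintro t (rfl | ht)
  · simp [hp]
  · simp [hf t ht, hk t ht]

theorem AffinelyInterpolating.affineIndependent {T : Set E} (hT : AffinelyInterpolating T) :
    AffineIndependent ℝ ((↑) : T → E) := by
  classical
  rw [affineIndependent_iff]
  intro s w hw hs e he
  obtain ⟨f, hf⟩ := hT (fun x => if x = e then 1 else 0)
  have h1 : ∑ i ∈ s, w i * f i = w e := by
    rw [Finset.sum_eq_single e]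
    · rw [hf _ e.2]; simp
    · intro b _ hb
      rw [hf _ b.2, if_neg (fun h => hb (Subtype.ext h)), mul_zero]
    · exact fun h => absurd he h
  rw [← h1]
  have h2 : ∀ x, f x = f.linear x + f 0 := fun x => by rw [f.decomp]; simp
  calc ∑ i ∈ s, w i * f i = f.linear (∑ i ∈ s, w i • (i : E)) + (∑ i ∈ s, w i) * f 0 := by
        rw [map_sum, Finset.sum_mul, ← Finset.sum_add_distrib]
        refine Finset.sum_congr rfl fun i _ => ?_
        rw [map_smul, h2 i, smul_eq_mul]; ring
    _ = 0 := by rw [hs, hw]; simp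

theorem AffineIndependent.affinelyInterpolating {T : Set E} (hfin : T.Finite)
    (hT : AffineIndependent ℝ ((↑) : T → E)) : AffinelyInterpolating T := by
  classical
  intro g
  obtain ⟨B, hTB, hB, htop⟩ := exists_subset_affineIndependent_affineSpan_eq_top hT
  let b : AffineBasis B ℝ E := ⟨(↑), hB, by simpa using htop⟩
  have : Finite T := hfin
  have : Fintype T := Fintype.ofFinite T
  obtain ⟨f, hf⟩ := AffineMap.exists_eq_sum (Finset.univ : Finset T)
    fun i => g i • b.coord ⟨i, hTB i.2⟩
  refine ⟨f, fun t ht => ?_⟩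
  rw [hf, Finset.sum_eq_single ⟨t, ht⟩]
  · have : b.coord ⟨t, hTB ht⟩ (b ⟨t, hTB ht⟩) = 1 := b.coord_apply_eq _
    have h2 : b.coord ⟨t, hTB ht⟩ t = 1 := this
    simp [h2]
  · intro i _ hi
    have : b.coord ⟨i, hTB i.2⟩ (b ⟨t, hTB ht⟩) = 0 :=
      b.coord_apply_ne fun h => hi (Subtype.ext (congrArg (fun z : B => (z : E)) h))
    have h2 : b.coord ⟨i, hTB i.2⟩ t = 0 := this
    simp [h2]
  · simp

theorem simplexFaceSets_finite {V : Set E} (hV : V.Finite) : (simplexFaceSets V).Finite :=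
  hV.finite_subsets.subset fun _ hT => hT.1.1

theorem empty_mem_simplexFaceSets (V : Set E) : ∅ ∈ simplexFaceSets V :=
  ⟨⟨Set.empty_subset _, AffineMap.const ℝ E 1, by simp⟩, affinelyInterpolating_empty⟩

theorem InConvexPosition.singleton_mem {V : Set E} (hV : InConvexPosition V) {v : E} (hv : v ∈ V) :
    {v} ∈ simplexFaceSets V :=
  ⟨hV v hv, affinelyInterpolating_singleton v⟩

/-- The subsets of the vertex set of a simplex face span simplex faces: a large multiple of the
function that cuts out the big face is added to one that cuts out the subset within it. -/
theorem simplexFaceSets_of_subset {V S T : Set E} (hV : V.Finite) (hT : T ∈ simplexFaceSets V)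
    (hST : S ⊆ T) : S ∈ simplexFaceSets V := by
  classical
  obtain ⟨⟨hTV, f, hf⟩, hi⟩ := hT
  obtain ⟨g, hg⟩ := hi fun x => if x ∈ S then 0 else 1
  refine ⟨⟨hST.trans hTV, ?_⟩, hi.mono hST⟩
  -- one constant `C` makes `C * f + g` positive on the finite set `V \ T`
  have : ∃ C : ℝ, ∀ v ∈ V, v ∉ T → 0 < C * f v + g v := by
    obtain ⟨C, hC⟩ := (hV.image fun v => (1 - g v) / f v).bddAbove
    refine ⟨C, fun v hv hvT => ?_⟩
    have hpos : 0 < f v := lt_of_le_of_ne (hf v hv).1 fun h => hvT ((hf v hv).2.1 h.symm)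
    have : (1 - g v) / f v ≤ C := hC (Set.mem_image_of_mem _ hv)
    rw [div_le_iff₀ hpos] at this
    linarith
  obtain ⟨C, hC⟩ := this
  refine ⟨C • f + g, fun v hv => ?_⟩
  simp only [AffineMap.coe_add, AffineMap.coe_smul, Pi.add_apply, Pi.smul_apply, smul_eq_mul]
  by_cases hvT : v ∈ T
  · rw [(hf v hv).2.2 hvT, hg v hvT]
    by_cases hvS : v ∈ S <;> simp [hvS]
  · have := hC v hv hvT
    exact ⟨this.le, fun h => absurd h this.ne', fun h => absurd (hST h) hvT⟩

/-! ### Simplex faces of a convex hull -/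

/-- An affine function that is nonnegative on `V` is nonnegative on the convex hull, and its zeros
there are convex combinations of its zeros in `V`. -/
theorem mem_convexHull_of_eq_zero {V : Set E} {f : E →ᵃ[ℝ] ℝ} (hf : ∀ v ∈ V, 0 ≤ f v) {x : E}
    (hx : x ∈ convexHull ℝ V) : 0 ≤ f x ∧ (f x = 0 → x ∈ convexHull ℝ {v ∈ V | f v = 0}) := by
  set W := convexHull ℝ {v ∈ V | f v = 0} with hW
  have hW0 : ∀ y ∈ W, f y = 0 := by
    have : W ⊆ f ⁻¹' {0} :=
      convexHull_min (fun v hv => hv.2) ((convex_singleton (0 : ℝ)).affine_preimage f)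
    exact fun y hy => this hy
  -- the points where `f` is positive form, together with `W`, a convex set containing `V`
  have hmin : convexHull ℝ V ⊆ {y | 0 < f y} ∪ W := by
    refine convexHull_min (fun v hv => ?_) ?_
    · rcases (hf v hv).lt_or_eq with h | h
      · exact Or.inl h
      · exact Or.inr (subset_convexHull ℝ _ ⟨hv, h.symm⟩)
    · rw [convex_iff_forall_pos]
      intro y hy z hz a b ha hb hab
      have key : f (a • y + b • z) = a * f y + b * f z := by
        have := Convex.combo_affine_apply (f := f) (x := y) (y := z) hab
        simpa using this
      have h0 : ∀ y ∈ {y | 0 < f y} ∪ W, 0 ≤ f y := by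
        rintro y (h | h)
        · exact le_of_lt h
        · exact (hW0 y h).ge
      have hy0 := h0 y hy
      have hz0 := h0 z hz
      rcases hy with hy | hy
      · left
        have hy' : 0 < f y := hy
        show 0 < f _
        rw [key]; positivity
      · rcases hz with hz | hz
        · left
          have hz' : 0 < f z := hz
          show 0 < f _
          rw [key]; positivity
        · exact Or.inr ((convex_convexHull ℝ _) hy hz ha.le hb.le hab)
  rcases hmin hx with h | h
  · exact ⟨le_of_lt h, fun h0 => absurd h0 (ne_of_gt h)⟩
  · exact ⟨(hW0 x h).ge, fun _ => h⟩

theorem CutsOutFace.mem_convexHull_iff {V T : Set E} {f : E →ᵃ[ℝ] ℝ} (hTV : T ⊆ V)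
    (hf : ∀ v ∈ V, 0 ≤ f v ∧ (f v = 0 ↔ v ∈ T)) {x : E} (hx : x ∈ convexHull ℝ V) :
    x ∈ convexHull ℝ T ↔ f x = 0 := by
  constructor
  · intro h
    have : convexHull ℝ T ⊆ f ⁻¹' {0} :=
      convexHull_min (fun v hv => (hf v (hTV hv)).2.2 hv)
        ((convex_singleton (0 : ℝ)).affine_preimage f)
    exact this h
  · intro h
    have := (mem_convexHull_of_eq_zero (fun v hv => (hf v hv).1) hx).2 h
    convert this using 2
    ext v
    exact ⟨fun hv => ⟨hTV hv, (hf v (hTV hv)).2.2 hv⟩, fun hv => (hf v hv.1).2.1 hv.2⟩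

theorem CutsOutFace.inter_convexHull {V T : Set E} (hT : CutsOutFace V T) :
    V ∩ convexHull ℝ T = T := by
  obtain ⟨hTV, f, hf⟩ := hT
  ext v
  refine ⟨fun hv => ?_, fun hv => ⟨hTV hv, subset_convexHull ℝ _ hv⟩⟩
  exact (hf v hv.1).2.1
    ((CutsOutFace.mem_convexHull_iff hTV hf (subset_convexHull ℝ _ hv.1)).1 hv.2)

variable [TopologicalSpace E] [IsTopologicalAddGroup E] [ContinuousSMul ℝ E] [T2Space E]
  [FiniteDimensional ℝ E]

theorem CutsOutFace.isExposed {V T : Set E} (hT : CutsOutFace V T) :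
    IsExposed ℝ (convexHull ℝ V) (convexHull ℝ T) := by
  intro hne
  obtain ⟨t, ht⟩ := convexHull_nonempty_iff.1 hne
  obtain ⟨hTV, f, hf⟩ := hT
  refine ⟨-(LinearMap.toContinuousLinearMap f.linear), ?_⟩
  have hl : ∀ x y, (-(LinearMap.toContinuousLinearMap f.linear)) x ≤
      (-(LinearMap.toContinuousLinearMap f.linear)) y ↔ f y ≤ f x := by
    intro x y
    rw [f.decomp]
    simp
  simp only [hl]
  have hnn : ∀ x ∈ convexHull ℝ V, 0 ≤ f x := fun x hx =>
    (mem_convexHull_of_eq_zero (fun v hv => (hf v hv).1) hx).1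
  ext x
  constructor
  · intro hx
    have hxV := convexHull_mono hTV hx
    exact ⟨hxV, fun y hy =>
      ((CutsOutFace.mem_convexHull_iff hTV hf hxV).1 hx).trans_le (hnn y hy)⟩
  · rintro ⟨hxV, hx⟩
    rw [CutsOutFace.mem_convexHull_iff hTV hf hxV]
    refine le_antisymm ?_ (hnn x hxV)
    have := hx t (subset_convexHull ℝ _ (hTV ht))
    rwa [(hf t (hTV ht)).2.2 ht] at this

/-- The simplex faces of a polytope correspond to their vertex sets. -/
theorem isSimplexFace_convexHull_iff {V : Set E} (hV : V.Finite) (hpos : InConvexPosition V)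
    (K : Set E) :
    IsSimplexFace (convexHull ℝ V) K ↔ ∃ T ∈ simplexFaceSets V, convexHull ℝ T = K := by
  constructor
  · rintro ⟨hexp, B, hB, rfl⟩
    rcases Set.eq_empty_or_nonempty (convexHull ℝ (B : Set E)) with h0 | hne
    · exact ⟨∅, empty_mem_simplexFaceSets V, by rw [h0, convexHull_empty]⟩
    obtain ⟨l, hl⟩ := hexp hne
    obtain ⟨x₀, hx₀⟩ := hne
    have hx₀' : x₀ ∈ {x ∈ convexHull ℝ V | ∀ y ∈ convexHull ℝ V, l y ≤ l x} := hl ▸ hx₀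
    let f : E →ᵃ[ℝ] ℝ := AffineMap.const ℝ E (l x₀) - (l : E →ₗ[ℝ] ℝ).toAffineMap
    have hfx : ∀ x, f x = l x₀ - l x := fun x => rfl
    have hmem : ∀ x ∈ convexHull ℝ V, x ∈ convexHull ℝ (B : Set E) ↔ f x = 0 := by
      intro x hx
      rw [hl, hfx]
      constructor
      · intro h
        have := h.2 x₀ hx₀'.1
        have := hx₀'.2 x hx
        linarith
      · intro h
        refine ⟨hx, fun y hy => ?_⟩
        have := hx₀'.2 y hy
        linarith
    have hfV : ∀ v ∈ V, 0 ≤ f v := fun v hv => by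
      have := hx₀'.2 v (subset_convexHull ℝ _ hv)
      rw [hfx]; linarith
    have hsub : convexHull ℝ (B : Set E) ⊆ convexHull ℝ V := by
      rw [hl]; exact fun x hx => hx.1
    set T : Set E := {v ∈ V | f v = 0} with hT
    have hTconv : convexHull ℝ T = convexHull ℝ (B : Set E) := by
      apply subset_antisymm
      · exact convexHull_min (fun v hv => (hmem v (subset_convexHull ℝ _ hv.1)).2 hv.2)
          (convex_convexHull ℝ _)
      · intro x hx
        exact (mem_convexHull_of_eq_zero hfV (hsub hx)).2 ((hmem x (hsub hx)).1 hx)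
    have hcut : CutsOutFace V T :=
      ⟨fun v hv => hv.1, f, fun v hv => ⟨hfV v hv, ⟨fun h => ⟨hv, h⟩, fun h => h.2⟩⟩⟩
    refine ⟨T, ⟨hcut, ?_⟩, hTconv⟩
    have hBi : AffinelyInterpolating (B : Set E) :=
      AffineIndependent.affinelyInterpolating B.finite_toSet hB
    -- `v ∈ T` is a vertex, and a convex combination of points of `B`, hence one of them
    refine hBi.mono fun v hv => ?_
    obtain ⟨hvV, g, hg⟩ := hpos v hv.1
    have hgK : ∀ x ∈ convexHull ℝ V, 0 ≤ g x := fun x hx =>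
      (mem_convexHull_of_eq_zero (fun v hv => (hg v hv).1) hx).1
    have hBV : ∀ b ∈ (B : Set E), b ∈ convexHull ℝ V := fun b hb =>
      hsub (subset_convexHull ℝ _ hb)
    have hvB : v ∈ convexHull ℝ (B : Set E) := hTconv ▸ subset_convexHull ℝ _ hv
    have h1 := (mem_convexHull_of_eq_zero (fun b hb => hgK b (hBV b hb)) hvB).2
      ((hg v hv.1).2.2 rfl)
    obtain ⟨b, hbB, hb0⟩ := convexHull_nonempty_iff.1 ⟨v, h1⟩
    have := (CutsOutFace.mem_convexHull_iff hvV hg (hBV b hbB)).2 hb0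
    rw [convexHull_singleton, Set.mem_singleton_iff] at this
    exact this ▸ hbB
  · rintro ⟨T, ⟨hT, hi⟩, rfl⟩
    obtain ⟨B, rfl⟩ := (hV.subset hT.1).exists_finset_coe
    exact ⟨hT.isExposed, B, hi.affineIndependent, rfl⟩

theorem setOf_isSimplexFace_eq_image {V : Set E} (hV : V.Finite) (hpos : InConvexPosition V) :
    {K | IsSimplexFace (convexHull ℝ V) K} = (fun T => convexHull ℝ T) '' simplexFaceSets V := by
  ext K
  exact isSimplexFace_convexHull_iff hV hpos K

theorem ncard_isSimplexFace {V : Set E} (hV : V.Finite) (hpos : InConvexPosition V) :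
    {K | IsSimplexFace (convexHull ℝ V) K}.ncard = (simplexFaceSets V).ncard := by
  rw [setOf_isSimplexFace_eq_image hV hpos]
  refine Set.InjOn.ncard_image fun S hS T hT h => ?_
  rw [← hS.1.inter_convexHull, ← hT.1.inter_convexHull]
  exact congrArg (V ∩ ·) h

end Faces

/-! ### The simplex-counting polynomial -/

section Poly

variable {E F : Type u} [AddCommGroup E] [Module ℝ E] [AddCommGroup F] [Module ℝ F]

theorem affDim_mono [FiniteDimensional ℝ E] {A B : Set E} (h : A ⊆ B) : affDim A ≤ affDim B := by
  classical
  unfold affDim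
  by_cases hA : A = ∅
  · rw [if_pos hA]
    split_ifs
    · exact le_rfl
    · exact (by norm_num : (-1 : ℤ) ≤ 0).trans (Int.natCast_nonneg _)
  · have hB : B ≠ ∅ := fun hB => hA (Set.subset_empty_iff.1 (hB ▸ h))
    rw [if_neg hA, if_neg hB]
    exact_mod_cast Submodule.finrank_mono (vectorSpan_mono ℝ h)

theorem neg_one_le_affDim (A : Set E) : -1 ≤ affDim A := by
  unfold affDim
  split_ifs
  · exact le_rfl
  · exact (by norm_num : (-1 : ℤ) ≤ 0).trans (Int.natCast_nonneg _)

/-- The value at `1` is the total number of simplex faces: their dimensions are at most that of the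
polytope. -/
theorem eval_one_simplexPoly [TopologicalSpace E] [FiniteDimensional ℝ E] {K : Set E}
    (hfin : {G | IsSimplexFace K G}.Finite) :
    (simplexPoly K).eval 1 = {G | IsSimplexFace K G}.ncard := by
  classical
  have hdim : ∀ G ∈ hfin.toFinset, (affDim G + 1).toNat ∈
      Finset.range (affDim K + 2).toNat := by
    intro G hG
    have hG' : IsSimplexFace K G := by simpa using hG
    have h1 := affDim_mono hG'.1.subset
    have h2 := neg_one_le_affDim G
    rw [Finset.mem_range]
    omega
  rw [Set.ncard_eq_toFinset_card _ hfin, Finset.card_eq_sum_card_fiberwise hdim]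
  unfold simplexPoly
  rw [Polynomial.eval_finsetSum]
  refine Finset.sum_congr rfl fun j _ => ?_
  rw [Polynomial.eval_mul, Polynomial.eval_C, Polynomial.eval_pow, Polynomial.eval_X, one_pow,
    mul_one]
  unfold numSimplexFaces
  rw [← Set.ncard_coe_finset]
  congr 1
  ext G
  simp only [Set.mem_ofPred_eq, Finset.coe_filter, Set.Finite.mem_toFinset]
  have := neg_one_le_affDim G
  constructor
  · rintro ⟨h, h'⟩
    exact ⟨h, by omega⟩
  · rintro ⟨h, h'⟩
    exact ⟨h, by omega⟩

theorem affDim_image (e : E ≃ᵃ[ℝ] F) (A : Set E) : affDim (e '' A) = affDim A := by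
  unfold affDim
  simp only [Set.image_eq_empty]
  split_ifs
  · rfl
  · have : vectorSpan ℝ (e '' A) = (vectorSpan ℝ A).map (e.linear : E →ₗ[ℝ] F) :=
      (AffineMap.map_vectorSpan (f := (e : E →ᵃ[ℝ] F)) (s := A)).symm
    rw [this, LinearEquiv.finrank_map_eq]

theorem IsSimplex.image {A : Set E} (h : IsSimplex A) (e : E ≃ᵃ[ℝ] F) : IsSimplex (e '' A) := by
  classical
  obtain ⟨V, hV, rfl⟩ := h
  refine ⟨V.image e, ?_, ?_⟩
  · have := (AffineEquiv.affineIndependent_set_of_eq_iff (s := (V : Set E)) e).2 hV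
    rw [← Finset.coe_image] at this
    exact this
  · rw [Finset.coe_image]
    exact (AffineMap.image_convexHull (e : E →ᵃ[ℝ] F) (V : Set E))

variable [TopologicalSpace E] [TopologicalSpace F] [IsTopologicalAddGroup F] [ContinuousSMul ℝ F]
  [T2Space F] [FiniteDimensional ℝ F]

theorem IsSimplexFace.image {K G : Set E} (h : IsSimplexFace K G) (e : E ≃ᵃ[ℝ] F) :
    IsSimplexFace (e '' K) (e '' G) := by
  refine ⟨fun hne => ?_, h.2.image e⟩
  obtain ⟨l, hl⟩ := h.1 (Set.image_nonempty.1 hne)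
  refine ⟨LinearMap.toContinuousLinearMap ((l : E →ₗ[ℝ] ℝ) ∘ₗ (e.linear.symm : F →ₗ[ℝ] E)), ?_⟩
  have key : ∀ x y, l (e.linear.symm (e y)) ≤ l (e.linear.symm (e x)) ↔ l y ≤ l x := by
    intro x y
    have h2 : ∀ x, e.linear.symm (e x) = x + e.linear.symm (e 0) := by
      intro x
      rw [LinearEquiv.symm_apply_eq, map_add, LinearEquiv.apply_symm_apply]
      have := e.map_vadd 0 x
      simpa using this
    rw [h2 x, h2 y, map_add, map_add]
    exact add_le_add_iff_right _
  ext z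
  constructor
  · rintro ⟨x, hx, rfl⟩
    rw [hl] at hx
    refine ⟨⟨x, hx.1, rfl⟩, ?_⟩
    rintro _ ⟨y, hy, rfl⟩
    exact (key x y).2 (hx.2 y hy)
  · rintro ⟨⟨x, hx, rfl⟩, h⟩
    refine ⟨x, ?_, rfl⟩
    rw [hl]
    exact ⟨hx, fun y hy => (key x y).1 (h _ ⟨y, hy, rfl⟩)⟩

variable [IsTopologicalAddGroup E] [ContinuousSMul ℝ E] [T2Space E] [FiniteDimensional ℝ E]

theorem numSimplexFaces_image (e : E ≃ᵃ[ℝ] F) (K : Set E) (k : ℤ) :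
    numSimplexFaces (e '' K) k = numSimplexFaces K k := by
  unfold numSimplexFaces
  rw [← Set.InjOn.ncard_image (f := fun G : Set E => e '' G)
    (Set.injOn_of_injective e.injective.image_injective)]
  congr 1
  ext G
  constructor
  · rintro ⟨h, rfl⟩
    have h' := h.image e.symm
    have hs : ∀ A : Set E, e.symm '' (e '' A) = A := fun A => by
      rw [Set.image_image]; simp
    have hs' : e '' (e.symm '' G) = G := by
      rw [Set.image_image]; simp
    rw [hs] at h'
    refine ⟨e.symm '' G, ⟨h', ?_⟩, hs'⟩
    rw [affDim_image]
  · rintro ⟨A, ⟨h, rfl⟩, rfl⟩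
    exact ⟨h.image e, affDim_image e A⟩

theorem simplexPoly_image (e : E ≃ᵃ[ℝ] F) (K : Set E) :
    simplexPoly (e '' K) = simplexPoly K := by
  unfold simplexPoly
  simp only [numSimplexFaces_image, affDim_image]

end Poly

/-! ### Counting simplex faces -/

section Count

variable {E F : Type*} [AddCommGroup E] [Module ℝ E] [AddCommGroup F] [Module ℝ F]

/-- The simplex faces whose vertex set contains `p`. -/
def simplexFaceSetsThrough (V : Set E) (p : E) : Set (Set E) :=
  {T ∈ simplexFaceSets V | p ∈ T}

/-- The simplex faces whose vertex set does not contain `p`. -/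
def simplexFaceSetsAvoiding (V : Set E) (p : E) : Set (Set E) :=
  {T ∈ simplexFaceSets V | p ∉ T}

theorem ncard_simplexFaceSets_eq {V : Set E} (hV : V.Finite) (p : E) :
    (simplexFaceSets V).ncard =
      (simplexFaceSetsThrough V p).ncard + (simplexFaceSetsAvoiding V p).ncard := by
  have hfin := simplexFaceSets_finite hV
  rw [← Set.ncard_union_eq (Set.disjoint_left.2 fun T h h' => h'.2 h.2)
    (hfin.subset fun T hT => hT.1) (hfin.subset fun T hT => hT.1)]
  congr 1
  ext T
  simp only [simplexFaceSetsThrough, simplexFaceSetsAvoiding, Set.mem_union, Set.mem_ofPred_eq]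
  tauto

theorem diff_singleton_injOn {α : Type*} (p : α) :
    Set.InjOn (fun T : Set α => T \ {p}) {T | p ∈ T} := by
  intro S hS T hT h
  have h1 := Set.insert_sdiff_self_of_mem (show p ∈ S from hS)
  have h2 := Set.insert_sdiff_self_of_mem (show p ∈ T from hT)
  simp only at h
  rw [← h1, ← h2, h]

theorem diff_singleton_mem_avoiding {V T : Set E} (hV : V.Finite) {p : E}
    (hT : T ∈ simplexFaceSetsThrough V p) : T \ {p} ∈ simplexFaceSetsAvoiding V p :=
  ⟨simplexFaceSets_of_subset hV hT.1 Set.sdiff_subset, by simp⟩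

/-- Deleting the vertex `p` maps the simplex faces through `p` injectively to those avoiding it. -/
theorem ncard_through_le_avoiding {V : Set E} (hV : V.Finite) (p : E) :
    (simplexFaceSetsThrough V p).ncard ≤ (simplexFaceSetsAvoiding V p).ncard :=
  Set.ncard_le_ncard_of_injOn (fun T => T \ {p}) (fun _ hT => diff_singleton_mem_avoiding hV hT)
    ((diff_singleton_injOn p).mono fun _ hT => hT.2)
    ((simplexFaceSets_finite hV).subset fun _ hT => hT.1)

theorem ncard_through_lt_avoiding {V S : Set E} (hV : V.Finite) (p : E)
    (hS : S ∈ simplexFaceSetsAvoiding V p) (hS' : insert p S ∉ simplexFaceSets V) :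
    (simplexFaceSetsThrough V p).ncard < (simplexFaceSetsAvoiding V p).ncard := by
  have hfin : (simplexFaceSetsAvoiding V p).Finite :=
    (simplexFaceSets_finite hV).subset fun _ hT => hT.1
  rw [← Set.InjOn.ncard_image (f := fun T => T \ {p})
    ((diff_singleton_injOn p).mono fun _ (hT : _ ∈ simplexFaceSetsThrough V p) => hT.2)]
  refine Set.ncard_lt_ncard ⟨?_, fun h => ?_⟩ hfin
  · rintro _ ⟨T, hT, rfl⟩
    exact diff_singleton_mem_avoiding hV hT
  · obtain ⟨T, hT, rfl⟩ := h hS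
    apply hS'
    simp only [Set.insert_sdiff_singleton]
    rw [Set.insert_eq_of_mem hT.2]
    exact hT.1

/-! ### Affine equivalences -/

theorem simplexFaceSets_image_mem (e : E ≃ᵃ[ℝ] F) {V T : Set E} (h : T ∈ simplexFaceSets V) :
    e '' T ∈ simplexFaceSets (e '' V) := by
  obtain ⟨⟨hTV, f, hf⟩, hi⟩ := h
  refine ⟨⟨Set.image_mono hTV, f.comp (e.symm : F →ᵃ[ℝ] E), ?_⟩, fun g => ?_⟩
  · rintro _ ⟨v, hv, rfl⟩
    have : e v ∈ e '' T ↔ v ∈ T := e.injective.mem_set_image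
    rw [this]
    simpa using hf v hv
  · obtain ⟨k, hk⟩ := hi (g ∘ e)
    refine ⟨k.comp (e.symm : F →ᵃ[ℝ] E), ?_⟩
    rintro _ ⟨t, ht, rfl⟩
    simpa using hk t ht

theorem simplexFaceSets_image (e : E ≃ᵃ[ℝ] F) (V : Set E) :
    simplexFaceSets (e '' V) = (fun T => e '' T) '' simplexFaceSets V := by
  ext T
  constructor
  · intro h
    have h' := simplexFaceSets_image_mem e.symm h
    rw [Set.image_image] at h'
    refine ⟨e.symm '' T, by simpa using h', ?_⟩
    simp only [Set.image_image]
    simp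
  · rintro ⟨S, hS, rfl⟩
    exact simplexFaceSets_image_mem e hS

theorem ncard_simplexFaceSets_image (e : E ≃ᵃ[ℝ] F) (V : Set E) :
    (simplexFaceSets (e '' V)).ncard = (simplexFaceSets V).ncard := by
  rw [simplexFaceSets_image,
    Set.InjOn.ncard_image (Set.injOn_of_injective e.injective.image_injective)]

theorem ncard_through_image (e : E ≃ᵃ[ℝ] F) (V : Set E) (p : E) :
    (simplexFaceSetsThrough (e '' V) (e p)).ncard = (simplexFaceSetsThrough V p).ncard := by
  rw [← Set.InjOn.ncard_image (f := fun T : Set E => e '' T)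
    (Set.injOn_of_injective e.injective.image_injective)]
  congr 1
  ext T
  unfold simplexFaceSetsThrough
  rw [simplexFaceSets_image]
  constructor
  · rintro ⟨⟨S, hS, rfl⟩, hp⟩
    exact ⟨S, ⟨hS, e.injective.mem_set_image.1 hp⟩, rfl⟩
  · rintro ⟨S, ⟨hS, hp⟩, rfl⟩
    exact ⟨⟨S, hS, rfl⟩, Set.mem_image_of_mem _ hp⟩

end Count

section Constructions

variable {E F : Type*} [AddCommGroup E] [Module ℝ E] [AddCommGroup F] [Module ℝ F]

theorem AffineMap.exists_apply_left (f : E × F →ᵃ[ℝ] ℝ) (q : F) :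
    ∃ g : E →ᵃ[ℝ] ℝ, ∀ x, g x = f (x, q) :=
  ⟨f.comp ((AffineMap.id ℝ E).prod (AffineMap.const ℝ E q)), fun _ => rfl⟩

theorem AffineMap.exists_apply_right (f : E × F →ᵃ[ℝ] ℝ) (p : E) :
    ∃ g : F →ᵃ[ℝ] ℝ, ∀ y, g y = f (p, y) :=
  ⟨f.comp ((AffineMap.const ℝ F p).prod (AffineMap.id ℝ F)), fun _ => rfl⟩

theorem AffineMap.exists_add_prod (f : E →ᵃ[ℝ] ℝ) (g : F →ᵃ[ℝ] ℝ) (c : ℝ) :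
    ∃ h : E × F →ᵃ[ℝ] ℝ, ∀ z, h z = f z.1 + g z.2 + c :=
  ⟨f.comp (LinearMap.fst ℝ E F).toAffineMap + g.comp (LinearMap.snd ℝ E F).toAffineMap +
    AffineMap.const ℝ _ c, fun _ => rfl⟩

theorem AffineMap.apply_prod (f : E × F →ᵃ[ℝ] ℝ) (v p : E) (w q : F) :
    f (v, w) = f (v, q) + f (p, w) - f (p, q) := by
  rw [← f.map_add_sub_real]
  congr 1
  ext <;> simp

/-! ### Simplex faces of a product -/

theorem prod_singleton_mem_simplexFaceSets {V T : Set E} {W : Set F} (hW : InConvexPosition W)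
    (hT : T ∈ simplexFaceSets V) {w : F} (hw : w ∈ W) :
    T ×ˢ {w} ∈ simplexFaceSets (V ×ˢ W) := by
  obtain ⟨⟨hTV, f, hf⟩, hi⟩ := hT
  obtain ⟨-, g, hg⟩ := hW w hw
  refine ⟨⟨Set.prod_mono hTV (by simpa using hw), ?_⟩, fun k => ?_⟩
  · obtain ⟨h, hh⟩ := AffineMap.exists_add_prod f g 0
    refine ⟨h, ?_⟩
    rintro ⟨x, y⟩ ⟨hx, hy⟩
    have h1 := hf x hx
    have h2 := hg y hy
    rw [hh, Set.mem_prod]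
    simp only at h1 h2 ⊢
    rw [← h1.2, ← h2.2]
    refine ⟨by linarith, fun h => ⟨by linarith, by linarith⟩, fun h => by linarith⟩
  · obtain ⟨a, ha⟩ := hi fun x => k (x, w)
    obtain ⟨h, hh⟩ := AffineMap.exists_add_prod a (0 : F →ᵃ[ℝ] ℝ) 0
    refine ⟨h, ?_⟩
    rintro ⟨x, y⟩ ⟨hx, hy⟩
    obtain rfl : y = w := hy
    simp [hh, ha x hx]

theorem singleton_prod_mem_simplexFaceSets {V : Set E} {W U : Set F} (hV : InConvexPosition V)
    (hU : U ∈ simplexFaceSets W) {v : E} (hv : v ∈ V) :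
    {v} ×ˢ U ∈ simplexFaceSets (V ×ˢ W) := by
  have h := simplexFaceSets_image_mem (LinearEquiv.prodComm ℝ F E).toAffineEquiv
    (prod_singleton_mem_simplexFaceSets hV hU hv)
  have hs : ∀ (A : Set F) (B : Set E),
      (LinearEquiv.prodComm ℝ F E).toAffineEquiv '' (A ×ˢ B) = B ×ˢ A := fun A B =>
    Set.image_swap_prod A B
  rwa [hs, hs] at h

/-- A nonempty simplex face of a product is the product of a simplex face and a vertex: two edges in
complementary directions would span a parallelogram. -/
theorem mem_simplexFaceSets_prod {V : Set E} {W : Set F} {R : Set (E × F)}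
    (hR : R ∈ simplexFaceSets (V ×ˢ W)) (hne : R.Nonempty) :
    (∃ T ∈ simplexFaceSets V, ∃ w ∈ W, R = T ×ˢ {w}) ∨
      ∃ v ∈ V, ∃ U ∈ simplexFaceSets W, R = {v} ×ˢ U := by
  classical
  obtain ⟨⟨hRV, f, hf⟩, hi⟩ := hR
  obtain ⟨⟨v₀, w₀⟩, h₀⟩ := hne
  have hv₀ := (hRV h₀).1
  have hw₀ := (hRV h₀).2
  simp only at hv₀ hw₀
  have f0 := (hf _ (hRV h₀)).2.2 h₀
  have hmem : ∀ v ∈ V, ∀ w ∈ W, (v, w) ∈ R ↔ (v, w₀) ∈ R ∧ (v₀, w) ∈ R := by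
    intro v hv w hw
    have h1 := hf (v, w) ⟨hv, hw⟩
    have h2 := hf (v, w₀) ⟨hv, hw₀⟩
    have h3 := hf (v₀, w) ⟨hv₀, hw⟩
    have h4 := f.apply_prod v v₀ w w₀
    rw [← h1.2, ← h2.2, ← h3.2]
    exact ⟨fun h => ⟨by linarith, by linarith⟩, fun h => by linarith⟩
  by_cases hU : ∃ w₁, (v₀, w₁) ∈ R ∧ w₁ ≠ w₀
  · obtain ⟨w₁, hw₁, hne₁⟩ := hU
    have hT : ∀ v, (v, w₀) ∈ R → v = v₀ := by
      intro v hv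
      by_contra hvne
      have h11 := (hmem v (hRV hv).1 w₁ (hRV hw₁).2).2 ⟨hv, hw₁⟩
      obtain ⟨g, hg⟩ := hi fun z => if z = (v, w₁) then 1 else 0
      have := g.apply_prod v v₀ w₁ w₀
      rw [hg _ h11, hg _ hv, hg _ hw₁, hg _ h₀] at this
      simp [hne₁.symm, Ne.symm hvne] at this
    right
    refine ⟨v₀, hv₀, {w | (v₀, w) ∈ R}, ⟨⟨fun w hw => (hRV hw).2, ?_⟩, fun g => ?_⟩, ?_⟩
    · obtain ⟨g, hg⟩ := f.exists_apply_right v₀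
      exact ⟨g, fun w hw => by rw [hg]; exact hf _ ⟨hv₀, hw⟩⟩
    · obtain ⟨k, hk⟩ := hi fun z => g z.2
      obtain ⟨k', hk'⟩ := k.exists_apply_right v₀
      exact ⟨k', fun w hw => by rw [hk']; exact hk _ hw⟩
    · ext ⟨v, w⟩
      constructor
      · intro h
        have h' := (hmem v (hRV h).1 w (hRV h).2).1 h
        exact ⟨hT v h'.1, h'.2⟩
      · rintro ⟨h, h'⟩
        obtain rfl : v = v₀ := h
        exact h'
  · push Not at hU
    left
    refine ⟨{v | (v, w₀) ∈ R}, ⟨⟨fun v hv => (hRV hv).1, ?_⟩, fun g => ?_⟩, w₀, hw₀, ?_⟩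
    · obtain ⟨g, hg⟩ := f.exists_apply_left w₀
      exact ⟨g, fun v hv => by rw [hg]; exact hf _ ⟨hv, hw₀⟩⟩
    · obtain ⟨k, hk⟩ := hi fun z => g z.1
      obtain ⟨k', hk'⟩ := k.exists_apply_left w₀
      exact ⟨k', fun v hv => by rw [hk']; exact hk _ hv⟩
    · ext ⟨v, w⟩
      constructor
      · intro h
        have h' := (hmem v (hRV h).1 w (hRV h).2).1 h
        exact ⟨h'.1, hU w h'.2⟩
      · rintro ⟨h, h'⟩
        obtain rfl : w = w₀ := h'
        exact h

theorem prod_singleton_injOn {α β : Type*} :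
    Set.InjOn (fun z : Set α × β => z.1 ×ˢ ({z.2} : Set β)) {z | z.1.Nonempty} := by
  rintro ⟨S, w⟩ ⟨x, hx⟩ ⟨S', w'⟩ ⟨x', hx'⟩ h
  simp only at h hx hx'
  have h2 : w = w' := by
    have : (x, w) ∈ S' ×ˢ ({w'} : Set β) := h ▸ ⟨hx, rfl⟩
    exact this.2
  subst h2
  refine Prod.ext ?_ rfl
  ext y
  have := Set.ext_iff.1 h (y, w)
  simpa using this

theorem singleton_prod_injOn {α β : Type*} :
    Set.InjOn (fun z : α × Set β => ({z.1} : Set α) ×ˢ z.2) {z | z.2.Nonempty} := by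
  rintro ⟨v, S⟩ ⟨x, hx⟩ ⟨v', S'⟩ ⟨x', hx'⟩ h
  simp only at h hx hx'
  have h2 : v = v' := by
    have : (v, x) ∈ ({v'} : Set α) ×ˢ S' := h ▸ ⟨rfl, hx⟩
    exact this.1
  subst h2
  refine Prod.ext rfl ?_
  ext y
  have := Set.ext_iff.1 h (v, y)
  simpa using this

theorem ncard_simplexFaceSets_sdiff_empty {V : Set E} (hV : V.Finite) :
    (simplexFaceSets V \ {∅}).ncard + 1 = (simplexFaceSets V).ncard :=
  Set.ncard_sdiff_singleton_add_one (empty_mem_simplexFaceSets V) (simplexFaceSets_finite hV)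

theorem ncard_simplexFaceSets_prod {V : Set E} {W : Set F} (hVf : V.Finite) (hWf : W.Finite)
    (hV : InConvexPosition V) (hW : InConvexPosition W) :
    (simplexFaceSets (V ×ˢ W)).ncard + V.ncard * W.ncard + V.ncard + W.ncard =
      1 + V.ncard * (simplexFaceSets W).ncard + W.ncard * (simplexFaceSets V).ncard := by
  set A := (fun z : Set E × F => z.1 ×ˢ ({z.2} : Set F)) '' ((simplexFaceSets V \ {∅}) ×ˢ W)
    with hA
  set B := (fun z : E × Set F => ({z.1} : Set E) ×ˢ z.2) '' (V ×ˢ (simplexFaceSets W \ {∅}))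
    with hB
  have hAB : simplexFaceSets (V ×ˢ W) \ {∅} = A ∪ B := by
    ext R
    constructor
    · rintro ⟨hR, hne⟩
      have hne : R.Nonempty := Set.nonempty_iff_ne_empty.2 hne
      rcases mem_simplexFaceSets_prod hR hne with ⟨T, hT, w, hw, rfl⟩ | ⟨v, hv, U, hU, rfl⟩
      · exact Or.inl ⟨(T, w), ⟨⟨hT, hne.fst.ne_empty⟩, hw⟩, rfl⟩
      · exact Or.inr ⟨(v, U), ⟨hv, ⟨hU, hne.snd.ne_empty⟩⟩, rfl⟩
    · rintro (⟨⟨T, w⟩, ⟨⟨hT, hne⟩, hw⟩, rfl⟩ | ⟨⟨v, U⟩, ⟨hv, ⟨hU, hne⟩⟩, rfl⟩)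
      · exact ⟨prod_singleton_mem_simplexFaceSets hW hT hw,
          ((Set.nonempty_iff_ne_empty.2 hne).prod (Set.singleton_nonempty _)).ne_empty⟩
      · exact ⟨singleton_prod_mem_simplexFaceSets hV hU hv,
          ((Set.singleton_nonempty _).prod (Set.nonempty_iff_ne_empty.2 hne)).ne_empty⟩
  have hinter : A ∩ B = (fun z : E × F => ({z} : Set (E × F))) '' (V ×ˢ W) := by
    ext R
    constructor
    · rintro ⟨⟨⟨T, w⟩, ⟨⟨hT, hT0⟩, hw⟩, rfl⟩, ⟨⟨v, U⟩, ⟨hv, ⟨hU, hU0⟩⟩, h⟩⟩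
      simp only at h hw hv hT0
      refine ⟨(v, w), ⟨hv, hw⟩, ?_⟩
      obtain ⟨t, ht⟩ := Set.nonempty_iff_ne_empty.2 hT0
      have hTv : ∀ t ∈ T, t = v := by
        intro t ht
        have : (t, w) ∈ ({v} : Set E) ×ˢ U := h ▸ ⟨ht, rfl⟩
        exact this.1
      ext ⟨x, y⟩
      simp only [Set.mem_singleton_iff, Prod.mk.injEq, Set.mem_prod]
      exact ⟨fun h => ⟨h.1 ▸ hTv t ht ▸ ht, h.2⟩, fun h => ⟨hTv x h.1, h.2⟩⟩
    · rintro ⟨⟨v, w⟩, ⟨hv, hw⟩, rfl⟩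
      exact ⟨⟨({v}, w), ⟨⟨hV.singleton_mem hv, Set.singleton_ne_empty v⟩, hw⟩,
        Set.singleton_prod_singleton⟩, ⟨(v, {w}), ⟨hv, ⟨hW.singleton_mem hw,
        Set.singleton_ne_empty w⟩⟩, Set.singleton_prod_singleton⟩⟩
  have cA : A.ncard = (simplexFaceSets V \ {∅}).ncard * W.ncard := by
    rw [hA, Set.InjOn.ncard_image, Set.ncard_prod]
    exact prod_singleton_injOn.mono fun z hz => Set.nonempty_iff_ne_empty.2 hz.1.2
  have cB : B.ncard = V.ncard * (simplexFaceSets W \ {∅}).ncard := by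
    rw [hB, Set.InjOn.ncard_image, Set.ncard_prod]
    exact singleton_prod_injOn.mono fun z hz => Set.nonempty_iff_ne_empty.2 hz.2.2
  have cI : (A ∩ B).ncard = V.ncard * W.ncard := by
    rw [hinter, Set.ncard_image_of_injective _ Set.singleton_injective, Set.ncard_prod]
  have fA : A.Finite := (((simplexFaceSets_finite hVf).subset Set.sdiff_subset).prod hWf).image _
  have fB : B.Finite := (hVf.prod ((simplexFaceSets_finite hWf).subset Set.sdiff_subset)).image _
  have hU := Set.ncard_union_add_ncard_inter A B fA fB
  have h1 := ncard_simplexFaceSets_sdiff_empty (hVf.prod hWf)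
  have h2 := ncard_simplexFaceSets_sdiff_empty hVf
  have h3 := ncard_simplexFaceSets_sdiff_empty hWf
  rw [hAB] at h1
  rw [cA, cB, cI] at hU
  rw [← h1, ← h2, ← h3]
  linarith

/-! ### Simplex faces of a wedge -/

/-- Two point sets glued along `p ∈ V` and `q ∈ W`, in complementary directions. -/
def wedge {α β : Type*} (V : Set α) (W : Set β) (p : α) (q : β) : Set (α × β) :=
  V ×ˢ {q} ∪ {p} ×ˢ W

theorem mem_wedge_left {α β : Type*} {V : Set α} {W : Set β} {p : α} {q : β}
    (h : p ∈ V ↔ q ∈ W) (v : α) :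
    (v, q) ∈ wedge V W p q ↔ v ∈ V := by
  simp only [wedge, Set.mem_union, Set.mem_prod, Set.mem_singleton_iff]
  constructor
  · rintro (h' | ⟨rfl, h'⟩)
    · exact h'.1
    · exact h.2 h'
  · exact fun h => Or.inl ⟨h, trivial⟩

theorem mem_wedge_right {α β : Type*} {V : Set α} {W : Set β} {p : α} {q : β}
    (h : p ∈ V ↔ q ∈ W) (w : β) :
    (p, w) ∈ wedge V W p q ↔ w ∈ W := by
  simp only [wedge, Set.mem_union, Set.mem_prod, Set.mem_singleton_iff]
  constructor
  · rintro (⟨h', rfl⟩ | h')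
    · exact h.1 h'
    · exact h'.2
  · exact fun h => Or.inr ⟨trivial, h⟩

/-- A simplex face and a further vertex are affinely independent, even if their join is not a
face. -/
theorem insert_interpolating_of_mem {V T : Set E} (hT : T ∈ simplexFaceSets V) {p : E}
    (hp : p ∈ V) : AffinelyInterpolating (insert p T) := by
  by_cases h : p ∈ T
  · rw [Set.insert_eq_of_mem h]
    exact hT.2
  · obtain ⟨⟨hTV, f, hf⟩, hi⟩ := hT
    exact hi.insert ⟨f, fun t ht => (hf t (hTV ht)).2.2 ht, fun h0 => h ((hf p hp).2.1 h0)⟩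

theorem wedge_mem_simplexFaceSets {V T : Set E} {W U : Set F} {p : E} {q : F} (hp : p ∈ V)
    (hq : q ∈ W) (hT : T ∈ simplexFaceSets V) (hU : U ∈ simplexFaceSets W) (h : p ∈ T ↔ q ∈ U) :
    wedge T U p q ∈ simplexFaceSets (wedge V W p q) := by
  have hiT := insert_interpolating_of_mem hT hp
  have hiU := insert_interpolating_of_mem hU hq
  obtain ⟨⟨hTV, f, hf⟩, -⟩ := hT
  obtain ⟨⟨hUW, g, hg⟩, -⟩ := hU
  refine ⟨⟨Set.union_subset_union (Set.prod_mono hTV subset_rfl) (Set.prod_mono subset_rfl hUW),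
    ?_⟩, fun k => ?_⟩
  · -- the two functions are rescaled so as to agree at the common point
    obtain ⟨a, b, ha, hb, hab⟩ : ∃ a b : ℝ, 0 < a ∧ 0 < b ∧ a * f p = b * g q := by
      by_cases hpT : p ∈ T
      · exact ⟨1, 1, one_pos, one_pos, by
          rw [(hf p hp).2.2 hpT, (hg q hq).2.2 (h.1 hpT)]⟩
      · refine ⟨g q, f p, lt_of_le_of_ne (hg q hq).1 ?_, lt_of_le_of_ne (hf p hp).1 ?_,
          mul_comm _ _⟩
        · exact fun h0 => hpT (h.2 ((hg q hq).2.1 h0.symm))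
        · exact fun h0 => hpT ((hf p hp).2.1 h0.symm)
    obtain ⟨k, hk⟩ := AffineMap.exists_add_prod (a • f) (b • g) (-(a * f p))
    refine ⟨k, ?_⟩
    rintro ⟨x, y⟩ (⟨hx, hy⟩ | ⟨hx, hy⟩)
    · obtain rfl : y = q := hy
      have : k (x, y) = a * f x := by rw [hk]; simp [hab]
      rw [this, mem_wedge_left h]
      exact ⟨mul_nonneg ha.le (hf x hx).1, by rw [← (hf x hx).2]; simp [ha.ne']⟩
    · obtain rfl : x = p := hx
      have : k (x, y) = b * g y := by rw [hk]; simp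
      rw [this, mem_wedge_right h]
      exact ⟨mul_nonneg hb.le (hg y hy).1, by rw [← (hg y hy).2]; simp [hb.ne']⟩
  · obtain ⟨k₁, hk₁⟩ := hiT fun x => k (x, q)
    obtain ⟨k₂, hk₂⟩ := hiU fun y => k (p, y) - k (p, q)
    obtain ⟨l, hl⟩ := AffineMap.exists_add_prod k₁ k₂ 0
    refine ⟨l, ?_⟩
    rintro ⟨x, y⟩ (⟨hx, hy⟩ | ⟨hx, hy⟩)
    · obtain rfl : y = q := hy
      rw [hl]
      simp [hk₁ x (Set.mem_insert_of_mem _ hx), hk₂ y (Set.mem_insert _ _)]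
    · obtain rfl : x = p := hx
      rw [hl]
      simp [hk₂ y (Set.mem_insert_of_mem _ hy), hk₁ x (Set.mem_insert _ _)]

/-- The two parts of a face of a wedge are its sections through the common vertex. -/
theorem mem_simplexFaceSets_wedge {V : Set E} {W : Set F} {p : E} {q : F} (hp : p ∈ V)
    (hq : q ∈ W) {R : Set (E × F)} (hR : R ∈ simplexFaceSets (wedge V W p q)) :
    ∃ T ∈ simplexFaceSets V, ∃ U ∈ simplexFaceSets W, (p ∈ T ↔ q ∈ U) ∧ wedge T U p q = R := by
  obtain ⟨⟨hRV, f, hf⟩, hi⟩ := hR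
  have hpq : p ∈ V ↔ q ∈ W := iff_of_true hp hq
  refine ⟨{v | (v, q) ∈ R}, ⟨⟨fun v hv => (mem_wedge_left hpq v).1 (hRV hv), ?_⟩, fun g => ?_⟩,
    {w | (p, w) ∈ R}, ⟨⟨fun w hw => (mem_wedge_right hpq w).1 (hRV hw), ?_⟩, fun g => ?_⟩,
    Iff.rfl, ?_⟩
  · obtain ⟨g, hg⟩ := f.exists_apply_left q
    exact ⟨g, fun v hv => by rw [hg]; exact hf _ ((mem_wedge_left hpq v).2 hv)⟩
  · obtain ⟨k, hk⟩ := hi fun z => g z.1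
    obtain ⟨k', hk'⟩ := k.exists_apply_left q
    exact ⟨k', fun v hv => by rw [hk']; exact hk _ hv⟩
  · obtain ⟨g, hg⟩ := f.exists_apply_right p
    exact ⟨g, fun w hw => by rw [hg]; exact hf _ ((mem_wedge_right hpq w).2 hw)⟩
  · obtain ⟨k, hk⟩ := hi fun z => g z.2
    obtain ⟨k', hk'⟩ := k.exists_apply_right p
    exact ⟨k', fun w hw => by rw [hk']; exact hk _ hw⟩
  · ext ⟨x, y⟩
    constructor
    · rintro (⟨hx, hy⟩ | ⟨hx, hy⟩)
      · obtain rfl : y = q := hy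
        exact hx
      · obtain rfl : x = p := hx
        exact hy
    · intro h
      rcases hRV h with (⟨hx, hy⟩ | ⟨hx, hy⟩)
      · obtain rfl : y = q := hy
        exact Or.inl ⟨h, rfl⟩
      · obtain rfl : x = p := hx
        exact Or.inr ⟨rfl, h⟩

/-- A face of a wedge is a wedge of two faces through the common vertex, or a join of two faces
avoiding it, and it is a simplex exactly if both parts are. -/
theorem ncard_simplexFaceSets_wedge {V : Set E} {W : Set F} (hVf : V.Finite) (hWf : W.Finite)
    {p : E} {q : F} (hp : p ∈ V) (hq : q ∈ W) :
    (simplexFaceSets (wedge V W p q)).ncard =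
      (simplexFaceSetsThrough V p).ncard * (simplexFaceSetsThrough W q).ncard +
      (simplexFaceSetsAvoiding V p).ncard * (simplexFaceSetsAvoiding W q).ncard := by
  have fV := simplexFaceSets_finite hVf
  have fW := simplexFaceSets_finite hWf
  set A := simplexFaceSetsThrough V p ×ˢ simplexFaceSetsThrough W q with hA
  set B := simplexFaceSetsAvoiding V p ×ˢ simplexFaceSetsAvoiding W q with hB
  have fA : A.Finite := (fV.subset fun _ h => h.1).prod (fW.subset fun _ h => h.1)
  have fB : B.Finite := (fV.subset fun _ h => h.1).prod (fW.subset fun _ h => h.1)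
  have hAB : Disjoint A B := Set.disjoint_left.2 fun z h h' => h'.1.2 h.1.2
  have himg : simplexFaceSets (wedge V W p q) =
      (fun z : Set E × Set F => wedge z.1 z.2 p q) '' (A ∪ B) := by
    ext R
    constructor
    · intro hR
      obtain ⟨T, hT, U, hU, h, rfl⟩ := mem_simplexFaceSets_wedge hp hq hR
      refine ⟨(T, U), ?_, rfl⟩
      by_cases hpT : p ∈ T
      · exact Or.inl ⟨⟨hT, hpT⟩, ⟨hU, h.1 hpT⟩⟩
      · exact Or.inr ⟨⟨hT, hpT⟩, ⟨hU, fun hq => hpT (h.2 hq)⟩⟩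
    · rintro ⟨⟨T, U⟩, (⟨h1, h2⟩ | ⟨h1, h2⟩), rfl⟩
      · exact wedge_mem_simplexFaceSets hp hq h1.1 h2.1 (iff_of_true h1.2 h2.2)
      · exact wedge_mem_simplexFaceSets hp hq h1.1 h2.1 (iff_of_false h1.2 h2.2)
  have hcoh : ∀ z ∈ A ∪ B, p ∈ z.1 ↔ q ∈ z.2 := by
    rintro z (⟨h1, h2⟩ | ⟨h1, h2⟩)
    · exact iff_of_true h1.2 h2.2
    · exact iff_of_false h1.2 h2.2
  have hinj : Set.InjOn (fun z : Set E × Set F => wedge z.1 z.2 p q) (A ∪ B) := by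
    intro z hz z' hz' h
    simp only at h
    refine Prod.ext (Set.ext fun v => ?_) (Set.ext fun w => ?_)
    · rw [← mem_wedge_left (hcoh z hz), h, mem_wedge_left (hcoh z' hz')]
    · rw [← mem_wedge_right (hcoh z hz), h, mem_wedge_right (hcoh z' hz')]
  rw [himg, hinj.ncard_image, Set.ncard_union_eq hAB fA fB, hA, hB, Set.ncard_prod, Set.ncard_prod]

end Constructions

section Vertices

variable {P : Type u} [PartialOrder P]

/-! ### Order and chain polytopes as convex hulls -/

variable (P) in
/-- The indicator vectors of the filters (upper sets) of `P`: the vertices of the order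
polytope. -/
def filterVectors : Set (P → ℝ) :=
  {x | (∀ p, x p = 0 ∨ x p = 1) ∧ Monotone x}

variable (P) in
/-- The indicator vectors of the antichains of `P`: the vertices of the chain polytope. -/
def antichainVectors : Set (P → ℝ) :=
  {x | (∀ p, x p = 0 ∨ x p = 1) ∧ ∀ p q, p < q → x p = 0 ∨ x q = 0}

theorem finite_zeroOne (α : Type*) [Finite α] : {x : α → ℝ | ∀ p, x p = 0 ∨ x p = 1}.Finite := by
  have := Set.Finite.pi' (t := fun _ : α => ({0, 1} : Set ℝ)) fun _ => Set.toFinite _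
  simpa using this

theorem filterVectors_finite [Finite P] : (filterVectors P).Finite :=
  (finite_zeroOne P).subset fun _ h => h.1

theorem antichainVectors_finite [Finite P] : (antichainVectors P).Finite :=
  (finite_zeroOne P).subset fun _ h => h.1

theorem inConvexPosition_zeroOne {α : Type*} [Finite α] {V : Set (α → ℝ)}
    (hV : ∀ x ∈ V, ∀ p, x p = 0 ∨ x p = 1) : InConvexPosition V := by
  classical
  have := Fintype.ofFinite α
  intro v hv
  refine ⟨by simpa using hv, ?_⟩
  obtain ⟨f, hf⟩ := AffineMap.exists_eq_sum (Finset.univ : Finset α) fun p =>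
    if v p = 1 then AffineMap.const ℝ _ 1 - (LinearMap.proj p : (α → ℝ) →ₗ[ℝ] ℝ).toAffineMap
    else (LinearMap.proj p : (α → ℝ) →ₗ[ℝ] ℝ).toAffineMap
  refine ⟨f, fun x hx => ?_⟩
  have hterm : ∀ p, (if v p = 1 then
      AffineMap.const ℝ _ 1 - (LinearMap.proj p : (α → ℝ) →ₗ[ℝ] ℝ).toAffineMap
      else (LinearMap.proj p : (α → ℝ) →ₗ[ℝ] ℝ).toAffineMap) x = if x p = v p then 0 else 1 := by
    intro p
    rcases hV v hv p with h | h <;> rcases hV x hx p with h' | h' <;> simp [h, h']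
  rw [hf, Finset.sum_congr rfl fun p _ => hterm p]
  have hnn : ∀ p ∈ Finset.univ, (0 : ℝ) ≤ if x p = v p then 0 else 1 := by
    intro p _
    split_ifs <;> norm_num
  refine ⟨Finset.sum_nonneg hnn, ?_⟩
  rw [Finset.sum_eq_zero_iff_of_nonneg hnn, Set.mem_singleton_iff]
  constructor
  · intro h
    ext p
    by_contra hp
    have := h p (Finset.mem_univ p)
    rw [if_neg hp] at this
    exact one_ne_zero this
  · rintro rfl
    simp

theorem inConvexPosition_filterVectors [Finite P] : InConvexPosition (filterVectors P) :=
  inConvexPosition_zeroOne fun _ h => h.1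

theorem inConvexPosition_antichainVectors [Finite P] : InConvexPosition (antichainVectors P) :=
  inConvexPosition_zeroOne fun _ h => h.1

open MeasureTheory in
/-- A vector is the average over `t` of the indicators of its level sets, where the coordinate `p`
is represented by the interval `(a p, b p]`. -/
theorem sub_mem_convexHull_of_levels {α : Type*} [Finite α] {V : Set (α → ℝ)} (hV : V.Finite)
    {a b : α → ℝ} (ha : ∀ p, 0 ≤ a p) (hab : ∀ p, a p ≤ b p) (hb : ∀ p, b p ≤ 1)
    (h : ∀ t ∈ Set.Ioc (0 : ℝ) 1, (fun p => (Set.Ioc (a p) (b p)).indicator 1 t) ∈ V) :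
    (fun p => b p - a p) ∈ convexHull ℝ V := by
  have := Fintype.ofFinite α
  set μ : Measure ℝ := volume.restrict (Set.Ioc 0 1) with hμ
  have : IsProbabilityMeasure μ := ⟨by simp [hμ]⟩
  set f : ℝ → α → ℝ := fun t p => (Set.Ioc (a p) (b p)).indicator 1 t with hf
  have hint : Integrable f μ := by
    refine Integrable.of_eval fun p => ?_
    exact (integrable_const (1 : ℝ)).indicator measurableSet_Ioc
  have hmem : ∫ t, f t ∂μ ∈ convexHull ℝ V := by
    refine (convex_convexHull ℝ V).integral_mem (hV.isClosed_convexHull (𝕜 := ℝ)) ?_ hint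
    rw [hμ, ae_restrict_iff' measurableSet_Ioc]
    exact Filter.Eventually.of_forall fun t ht => subset_convexHull ℝ V (h t ht)
  convert hmem using 1
  ext p
  rw [eval_integral fun p => hint.eval p]
  have h3 : ∫ t, f t p ∂μ = μ.real (Set.Ioc (a p) (b p)) := integral_indicator_one measurableSet_Ioc
  rw [h3, hμ, measureReal_restrict_apply measurableSet_Ioc,
    Set.inter_eq_left.2 (Set.Ioc_subset_Ioc (ha p) (hb p))]
  simp [Real.volume_real_Ioc_of_le (hab p)]

theorem convex_orderPolytope : Convex ℝ (orderPolytope P) := by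
  intro x hx y hy a b ha hb hab
  simp only [orderPolytope, Set.mem_ofPred_eq, Pi.add_apply, Pi.smul_apply, smul_eq_mul] at *
  refine ⟨fun p => ⟨?_, ?_⟩, fun p q hpq => ?_⟩
  · have := hx.1 p; have := hy.1 p
    nlinarith
  · have := hx.1 p; have := hy.1 p
    nlinarith
  · have := hx.2 p q hpq; have := hy.2 p q hpq
    nlinarith

theorem convex_chainPolytope : Convex ℝ (chainPolytope P) := by
  intro x hx y hy a b ha hb hab
  simp only [chainPolytope, Set.mem_ofPred_eq, Pi.add_apply, Pi.smul_apply, smul_eq_mul] at *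
  refine ⟨fun p => ?_, fun c hc => ?_⟩
  · have := hx.1 p; have := hy.1 p
    positivity
  · have h1 := hx.2 c hc; have h2 := hy.2 c hc
    rw [Finset.sum_add_distrib, ← Finset.mul_sum, ← Finset.mul_sum]
    nlinarith

theorem filterVectors_subset : filterVectors P ⊆ orderPolytope P := by
  rintro x ⟨h01, hm⟩
  refine ⟨fun p => ?_, fun p q hpq => hm hpq⟩
  rcases h01 p with h | h <;> simp [h]

theorem antichainVectors_subset : antichainVectors P ⊆ chainPolytope P := by
  classical
  rintro x ⟨h01, ha⟩
  refine ⟨fun p => ?_, fun c hc => ?_⟩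
  · rcases h01 p with h | h <;> simp [h]
  · by_cases h : ∃ p ∈ c, x p = 1
    · obtain ⟨p, hp, hp1⟩ := h
      rw [Finset.sum_eq_single p, hp1]
      · intro q hq hqp
        rcases hc hp hq hqp.symm with h | h
        · exact (ha p q (lt_of_le_of_ne h hqp.symm)).resolve_left (by simp [hp1])
        · exact (ha q p (lt_of_le_of_ne h hqp)).resolve_right (by simp [hp1])
      · exact fun h => absurd hp h
    · push Not at h
      rw [Finset.sum_eq_zero fun p hp => (h01 p).resolve_right (h p hp)]
      exact zero_le_one

theorem convexHull_filterVectors [Finite P] :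
    convexHull ℝ (filterVectors P) = orderPolytope P := by
  refine subset_antisymm (convexHull_min filterVectors_subset convex_orderPolytope) ?_
  intro x hx
  have := sub_mem_convexHull_of_levels filterVectors_finite (a := fun _ : P => 0) (b := x)
    (fun _ => le_rfl) (fun p => (hx.1 p).1) (fun p => (hx.1 p).2) ?_
  · simpa using this
  intro t ht
  refine ⟨fun p => ?_, fun p q hpq => ?_⟩
  · simp only [Set.indicator_apply]
    split_ifs <;> simp
  · simp only [Set.indicator_apply, Set.mem_Ioc, Pi.one_apply]
    have := hx.2 p q hpq
    split_ifs with h1 h2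
    · exact le_rfl
    · exact absurd ⟨h1.1, h1.2.trans this⟩ h2
    · exact zero_le_one
    · exact le_rfl

/-- The largest sum of coordinates along a chain strictly below a given element. -/
theorem exists_max_chain_sum_below [Finite P] (x : P → ℝ) :
    ∃ a : P → ℝ, ∀ p, (∃ c : Finset P, IsChain (· ≤ ·) (c : Set P) ∧ (∀ q ∈ c, q < p) ∧
      ∑ q ∈ c, x q = a p) ∧ ∀ c : Finset P, IsChain (· ≤ ·) (c : Set P) → (∀ q ∈ c, q < p) →
      ∑ q ∈ c, x q ≤ a p := by
  classical
  have := Fintype.ofFinite P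
  have key : ∀ p, ∃ r : ℝ, (∃ c : Finset P, IsChain (· ≤ ·) (c : Set P) ∧ (∀ q ∈ c, q < p) ∧
      ∑ q ∈ c, x q = r) ∧ ∀ c : Finset P, IsChain (· ≤ ·) (c : Set P) → (∀ q ∈ c, q < p) →
      ∑ q ∈ c, x q ≤ r := by
    intro p
    obtain ⟨c, hc, hmax⟩ := Finset.exists_max_image
      (Finset.univ.filter fun c : Finset P => IsChain (· ≤ ·) (c : Set P) ∧ ∀ q ∈ c, q < p)
      (fun c => ∑ q ∈ c, x q) ⟨∅, by simp⟩
    simp only [Finset.mem_filter, Finset.mem_univ, true_and] at hc hmax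
    exact ⟨_, ⟨c, hc.1, hc.2, rfl⟩, fun c' h h' => hmax c' ⟨h, h'⟩⟩
  choose a ha using key
  exact ⟨a, ha⟩

theorem convexHull_antichainVectors [Finite P] :
    convexHull ℝ (antichainVectors P) = chainPolytope P := by
  classical
  refine subset_antisymm (convexHull_min antichainVectors_subset convex_chainPolytope) ?_
  intro x hx
  obtain ⟨a, ha⟩ := exists_max_chain_sum_below x
  have hins : ∀ {c : Finset P} {p : P}, IsChain (· ≤ ·) (c : Set P) → (∀ q ∈ c, q < p) →
      IsChain (· ≤ ·) ((insert p c : Finset P) : Set P) ∧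
      ∑ q ∈ insert p c, x q = ∑ q ∈ c, x q + x p := by
    intro c p hc hlt
    refine ⟨?_, ?_⟩
    · rw [Finset.coe_insert]
      exact hc.insert fun q hq _ => Or.inr (hlt q hq).le
    · rw [Finset.sum_insert fun hp => lt_irrefl p (hlt p hp), add_comm]
  have := sub_mem_convexHull_of_levels antichainVectors_finite (a := a) (b := fun p => a p + x p)
    (fun p => ?_) (fun p => ?_) (fun p => ?_) ?_
  · simpa using this
  · simpa using (ha p).2 ∅ (by simp) (by simp)
  · simpa using hx.1 p
  · obtain ⟨c, hc, hlt, hsum⟩ := (ha p).1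
    rw [← hsum, ← (hins hc hlt).2]
    exact hx.2 _ (hins hc hlt).1
  · intro t ht
    refine ⟨fun p => ?_, fun p q hpq => ?_⟩
    · simp only [Set.indicator_apply]
      split_ifs <;> simp
    · -- the interval of `q` starts after the one of `p` ends
      have hle : a p + x p ≤ a q := by
        obtain ⟨c, hc, hlt, hsum⟩ := (ha p).1
        rw [← hsum, ← (hins hc hlt).2]
        refine (ha q).2 _ (hins hc hlt).1 fun r hr => ?_
        rcases Finset.mem_insert.1 hr with rfl | hr
        · exact hpq
        · exact (hlt r hr).trans hpq
      simp only [Set.indicator_apply, Set.mem_Ioc]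
      by_cases h : t ≤ a p + x p
      · right
        rw [if_neg]
        exact fun h' => absurd (h.trans hle) (not_le.2 h'.1)
      · left
        rw [if_neg]
        exact fun h' => h h'.2

theorem finite_and_ncard_isSimplexFace_orderPolytope [Finite P] :
    {G | IsSimplexFace (orderPolytope P) G}.Finite ∧
      {G | IsSimplexFace (orderPolytope P) G}.ncard =
        (simplexFaceSets (filterVectors P)).ncard := by
  rw [← convexHull_filterVectors]
  refine ⟨?_, ncard_isSimplexFace filterVectors_finite inConvexPosition_filterVectors⟩
  rw [setOf_isSimplexFace_eq_image filterVectors_finite inConvexPosition_filterVectors]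
  exact (simplexFaceSets_finite filterVectors_finite).image _

theorem finite_and_ncard_isSimplexFace_chainPolytope [Finite P] :
    {G | IsSimplexFace (chainPolytope P) G}.Finite ∧
      {G | IsSimplexFace (chainPolytope P) G}.ncard =
        (simplexFaceSets (antichainVectors P)).ncard := by
  rw [← convexHull_antichainVectors]
  refine ⟨?_, ncard_isSimplexFace antichainVectors_finite inConvexPosition_antichainVectors⟩
  rw [setOf_isSimplexFace_eq_image antichainVectors_finite inConvexPosition_antichainVectors]
  exact (simplexFaceSets_finite antichainVectors_finite).image _

theorem eval_one_simplexPoly_orderPolytope [Finite P] :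
    (simplexPoly (orderPolytope P)).eval 1 = (simplexFaceSets (filterVectors P)).ncard := by
  rw [← finite_and_ncard_isSimplexFace_orderPolytope.2]
  exact eval_one_simplexPoly finite_and_ncard_isSimplexFace_orderPolytope.1

theorem eval_one_simplexPoly_chainPolytope [Finite P] :
    (simplexPoly (chainPolytope P)).eval 1 = (simplexFaceSets (antichainVectors P)).ncard := by
  rw [← finite_and_ncard_isSimplexFace_chainPolytope.2]
  exact eval_one_simplexPoly finite_and_ncard_isSimplexFace_chainPolytope.1

/-! ### Filters and antichains -/

/-- A filter of a finite poset is generated by the antichain of its minimal elements. -/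
theorem ncard_filterVectors_eq [Finite P] :
    (filterVectors P).ncard = (antichainVectors P).ncard := by
  classical
  symm
  refine Set.ncard_congr (fun x _ p => if ∃ q ≤ p, x q = 1 then 1 else 0) ?_ ?_ ?_
  · rintro x -
    refine ⟨fun p => by dsimp only; split_ifs <;> simp, fun p q hpq => ?_⟩
    simp only
    split_ifs with h1 h2
    · exact le_rfl
    · obtain ⟨r, hr, hx⟩ := h1
      exact absurd ⟨r, hr.trans hpq, hx⟩ h2
    · exact zero_le_one
    · exact le_rfl
  · intro x y hx hy h
    have hiff : ∀ p, (∃ q ≤ p, x q = 1) ↔ ∃ q ≤ p, y q = 1 := by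
      intro p
      have := congrFun h p
      split_ifs at this with h1 h2 h2
      · exact iff_of_true h1 h2
      · exact absurd this one_ne_zero
      · exact absurd this zero_ne_one
      · exact iff_of_false h1 h2
    have hone : ∀ {x y : P → ℝ}, x ∈ antichainVectors P →
        (∀ p, (∃ q ≤ p, x q = 1) ↔ ∃ q ≤ p, y q = 1) → ∀ p, x p = 1 → y p = 1 := by
      intro x y hx hiff p hp
      obtain ⟨q, hqp, hq⟩ := (hiff p).1 ⟨p, le_rfl, hp⟩
      obtain ⟨r, hrq, hr⟩ := (hiff q).2 ⟨q, le_rfl, hq⟩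
      have : r = p := by
        by_contra hne
        rcases hx.2 r p (lt_of_le_of_ne (hrq.trans hqp) hne) with h | h
        · rw [hr] at h; exact one_ne_zero h
        · rw [hp] at h; exact one_ne_zero h
      subst this
      rwa [le_antisymm hrq hqp]
    ext p
    rcases hx.1 p with h0 | h1
    · rcases hy.1 p with h0' | h1'
      · rw [h0, h0']
      · have := hone hy (fun p => (hiff p).symm) p h1'
        rw [h0] at this; exact absurd this zero_ne_one
    · rw [h1, hone hx hiff p h1]
  · intro y hy
    refine ⟨fun p => if y p = 1 ∧ ∀ q < p, y q = 0 then 1 else 0, ⟨fun p => ?_, fun p q hpq => ?_⟩,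
      ?_⟩
    · simp only; split_ifs <;> simp
    · by_cases h1 : y p = 0
      · left; dsimp only; rw [if_neg]; rintro ⟨h, -⟩; rw [h1] at h; exact zero_ne_one h
      · right; dsimp only; rw [if_neg]; rintro ⟨-, h⟩; exact h1 (h p hpq)
    · ext p
      have : (∃ q ≤ p, (if y q = 1 ∧ ∀ r < q, y r = 0 then (1 : ℝ) else 0) = 1) ↔ y p = 1 := by
        constructor
        · rintro ⟨q, hqp, h⟩
          have hq : y q = 1 := by
            by_contra hq
            rw [if_neg fun h' => hq h'.1] at h
            exact zero_ne_one h
          refine (hy.1 p).resolve_left fun h0 => ?_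
          have := hy.2 hqp
          rw [h0, hq] at this
          exact absurd this (by norm_num)
        · intro hp
          obtain ⟨m, hmp, hm⟩ := exists_minimal_le_of_wellFoundedLT (fun q => y q = 1) p hp
          refine ⟨m, hmp, if_pos ⟨hm.prop, fun r hr => (hy.1 r).resolve_right fun h => ?_⟩⟩
          exact absurd (hm.le_of_le h hr.le) (not_le_of_gt hr)
      by_cases hp : y p = 1
      · rw [if_pos (this.2 hp), hp]
      · rw [if_neg fun h => hp (this.1 h), (hy.1 p).resolve_right hp]

end Vertices

/-! ### Cutting out faces by systems of equations -/

section CutOut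

variable {E : Type*} [AddCommGroup E] [Module ℝ E]

theorem cutsOutFace_of_apply_nonneg {V : Set E} {Q : E → Prop} (f : E →ᵃ[ℝ] ℝ)
    (hf : ∀ v ∈ V, 0 ≤ f v ∧ (f v = 0 ↔ Q v)) : CutsOutFace V {v ∈ V | Q v} :=
  ⟨fun _ h => h.1, f, fun v hv => ⟨(hf v hv).1, fun h => ⟨hv, (hf v hv).2.1 h⟩,
    fun h => (hf v hv).2.2 h.2⟩⟩

theorem cutsOutFace_forall {V : Set E} {ι : Type*} [Finite ι] {Q : ι → E → Prop}
    (h : ∀ i, CutsOutFace V {v ∈ V | Q i v}) : CutsOutFace V {v ∈ V | ∀ i, Q i v} := by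
  have := Fintype.ofFinite ι
  choose _ f hf using h
  obtain ⟨g, hg⟩ := AffineMap.exists_eq_sum Finset.univ f
  refine cutsOutFace_of_apply_nonneg g fun v hv => ?_
  have hnn : ∀ i ∈ Finset.univ, 0 ≤ f i v := fun i _ => (hf i v hv).1
  rw [hg]
  refine ⟨Finset.sum_nonneg hnn, ?_⟩
  rw [Finset.sum_eq_zero_iff_of_nonneg hnn]
  exact ⟨fun h i => ((hf i v hv).2.1 (h i (Finset.mem_univ i))).2,
    fun h i _ => (hf i v hv).2.2 ⟨hv, h i⟩⟩

theorem cutsOutFace_imp {V : Set E} {c : Prop} {Q : E → Prop}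
    (h : c → CutsOutFace V {v ∈ V | Q v}) : CutsOutFace V {v ∈ V | c → Q v} := by
  by_cases hc : c
  · simpa [hc] using h hc
  · exact cutsOutFace_of_apply_nonneg 0 fun v _ => by simp [hc]

theorem cutsOutFace_and {V : Set E} {Q R : E → Prop} (hQ : CutsOutFace V {v ∈ V | Q v})
    (hR : CutsOutFace V {v ∈ V | R v}) : CutsOutFace V {v ∈ V | Q v ∧ R v} := by
  have := cutsOutFace_forall (V := V) (Q := fun b : Bool => if b then Q else R)
    (by rintro (_ | _) <;> simpa)
  simpa [and_comm] using this

end CutOut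

section Chains

variable {P : Type u} [PartialOrder P]

theorem cutsOutFace_apply_eq_zero (p : P) :
    CutsOutFace (filterVectors P) {x ∈ filterVectors P | x p = 0} :=
  cutsOutFace_of_apply_nonneg (LinearMap.proj p : (P → ℝ) →ₗ[ℝ] ℝ).toAffineMap fun x hx => by
    rcases hx.1 p with h | h <;> simp [h]

theorem cutsOutFace_apply_eq_apply {p q : P} (hpq : p ≤ q) :
    CutsOutFace (filterVectors P) {x ∈ filterVectors P | x q = x p} :=
  cutsOutFace_of_apply_nonneg ((LinearMap.proj q : (P → ℝ) →ₗ[ℝ] ℝ).toAffineMap -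
    (LinearMap.proj p : (P → ℝ) →ₗ[ℝ] ℝ).toAffineMap) fun x hx => by
    have := hx.2 hpq
    simp [this, sub_eq_zero]

/-! ### Simplex faces of the chain polytope through the origin -/

open scoped Classical in
/-- On a simplex face of the chain polytope through the origin, all other vertices are unit
vectors: with the indicator of a larger antichain, the face would contain the indicators of its
parts, and these satisfy an affine relation. -/
theorem exists_eq_single_of_mem_face {T : Set (P → ℝ)}
    (hT : T ∈ simplexFaceSets (antichainVectors P)) (h0 : (0 : P → ℝ) ∈ T) {v : P → ℝ} (hv : v ∈ T)
    (hv0 : v ≠ 0) : ∃ p, v = Pi.single p 1 := by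
  obtain ⟨⟨hTV, f, hf⟩, hi⟩ := hT
  have hvV := hTV hv
  obtain ⟨p, hp⟩ : ∃ p, v p = 1 := by
    by_contra! h
    exact hv0 (funext fun p => (hvV.1 p).resolve_right (h p))
  refine ⟨p, ?_⟩
  by_contra hne
  obtain ⟨q, hqp, hq⟩ : ∃ q, q ≠ p ∧ v q = 1 := by
    by_contra! h
    apply hne
    ext q
    by_cases hqp : q = p
    · subst hqp; simp [hp]
    · simp [hqp, (hvV.1 q).resolve_right (h q hqp)]
  -- `0 + v = single p + v'` is a relation between four points of the face
  have h1 : Pi.single p 1 ∈ antichainVectors P := by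
    refine ⟨fun r => ?_, fun r s hrs => ?_⟩
    · by_cases h : r = p <;> simp [h]
    · by_cases h : r = p
      · right; subst h; simp [hrs.ne']
      · left; simp [h]
  have h2 : v - Pi.single p 1 ∈ antichainVectors P := by
    refine ⟨fun r => ?_, fun r s hrs => ?_⟩
    · by_cases h : r = p
      · subst h; simp [hp]
      · simpa [h] using hvV.1 r
    · by_cases h : r = p
      · left; subst h; simp [hp]
      · by_cases h' : s = p
        · right; subst h'; simp [hp]
        · simpa [h, h'] using hvV.2 r s hrs
  have hsum : v = Pi.single p 1 + (v - Pi.single p 1) - 0 := by simp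
  have hfs : ∀ k : (P → ℝ) →ᵃ[ℝ] ℝ, k v = k (Pi.single p 1) + k (v - Pi.single p 1) - k 0 := by
    intro k
    rw [← k.map_add_sub_real, ← hsum]
  have e1 := hfs f
  rw [(hf v hvV).2.2 hv, (hf 0 (hTV h0)).2.2 h0] at e1
  have n1 := (hf _ h1).1
  have n2 := (hf _ h2).1
  have m1 := (hf _ h1).2.1 (by linarith)
  have m2 := (hf _ h2).2.1 (by linarith)
  obtain ⟨k, hk⟩ := hi fun x => if x = v then 1 else 0
  have e2 := hfs k
  have hne2 : v - Pi.single p 1 ≠ v := fun h => by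
    have := congrFun h p
    simp at this
  rw [hk v hv, hk _ m1, hk _ m2, hk _ h0, if_pos rfl, if_neg (Ne.symm hne), if_neg hne2,
    if_neg (Ne.symm hv0)] at e2
  norm_num at e2

open scoped Classical in
theorem single_add_single_mem {p q : P} (hpq : ¬p ≤ q) (hqp : ¬q ≤ p) :
    (Pi.single p 1 + Pi.single q 1 : P → ℝ) ∈ antichainVectors P := by
  have hne : p ≠ q := fun h => hpq h.le
  refine ⟨fun r => ?_, fun r s hrs => ?_⟩
  · by_cases h : r = p
    · subst h; right; simp [hne]
    · by_cases h' : r = q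
      · subst h'; right; simp [h]
      · left; simp [h, h']
  · by_cases h : r = p ∨ r = q
    · right
      have h1 : s ≠ p := by
        rintro rfl
        rcases h with rfl | rfl
        · exact lt_irrefl _ hrs
        · exact hqp hrs.le
      have h2 : s ≠ q := by
        rintro rfl
        rcases h with rfl | rfl
        · exact hpq hrs.le
        · exact lt_irrefl _ hrs
      simp [h1, h2]
    · left
      push Not at h
      simp [h.1, h.2]

open scoped Classical in
theorem single_add_single_ne_single {α : Type*} {p q : α} (hpq : p ≠ q) (r : α) :
    (Pi.single p 1 + Pi.single q 1 : α → ℝ) ≠ Pi.single r 1 := by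
  intro h
  have h1 := congrFun h p
  have h2 := congrFun h q
  by_cases hp : p = r
  · subst hp; simp [hpq.symm] at h2
  · simp [hpq, hp] at h1

open scoped Classical in
theorem isChain_of_mem_face {T : Set (P → ℝ)} (hT : T ∈ simplexFaceSets (antichainVectors P))
    (h0 : (0 : P → ℝ) ∈ T) : IsChain (· ≤ ·) {p | Pi.single p 1 ∈ T} := by
  intro p hp q hq hne
  by_contra h
  simp only [not_or] at h
  have hw := single_add_single_mem h.1 h.2
  obtain ⟨⟨hTV, f, hf⟩, hi⟩ := id hT
  have hfs : f (Pi.single p 1 + Pi.single q 1) = 0 := by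
    have := f.map_add_sub_real (Pi.single p 1) (Pi.single q 1) 0
    rw [sub_zero] at this
    rw [this, (hf _ (hTV hp)).2.2 hp, (hf _ (hTV hq)).2.2 hq, (hf _ (hTV h0)).2.2 h0]
    norm_num
  have hwT := (hf _ hw).2.1 hfs
  obtain ⟨r, hr⟩ := exists_eq_single_of_mem_face hT h0 hwT fun h => by
    have := congrFun h p
    simp [hne] at this
  exact single_add_single_ne_single hne r hr

/-- The simplex faces of the chain polytope through the origin correspond to chains. -/
theorem ncard_through_antichainVectors_le [Finite P] :
    (simplexFaceSetsThrough (antichainVectors P) 0).ncard ≤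
      {c : Set P | IsChain (· ≤ ·) c}.ncard := by
  classical
  refine Set.ncard_le_ncard_of_injOn (fun T => {p | Pi.single p 1 ∈ T})
    (fun T hT => isChain_of_mem_face hT.1 hT.2) ?_ (Set.toFinite _)
  have key : ∀ S ∈ simplexFaceSetsThrough (antichainVectors P) 0,
      ∀ T ∈ simplexFaceSetsThrough (antichainVectors P) 0,
      {p | Pi.single p 1 ∈ S} = {p | Pi.single p 1 ∈ T} → S ⊆ T := by
    intro S hS T hT h v hv
    by_cases hv0 : v = 0
    · exact hv0 ▸ hT.2
    · obtain ⟨p, rfl⟩ := exists_eq_single_of_mem_face hS.1 hS.2 hv hv0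
      exact (Set.ext_iff.1 h p).1 hv
  exact fun S hS T hT h => subset_antisymm (key S hS T hT h) (key T hT S hS h.symm)

/-- Two incomparable elements span a vertex of the chain polytope whose join with the origin is not
a face. -/
theorem ncard_through_lt_avoiding_antichainVectors [Finite P] {p q : P} (hpq : ¬p ≤ q)
    (hqp : ¬q ≤ p) : (simplexFaceSetsThrough (antichainVectors P) 0).ncard <
      (simplexFaceSetsAvoiding (antichainVectors P) 0).ncard := by
  classical
  have hne : p ≠ q := fun h => hpq h.le
  have hw0 : (Pi.single p 1 + Pi.single q 1 : P → ℝ) ≠ 0 := fun h => by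
    have := congrFun h p
    simp [hne] at this
  refine ncard_through_lt_avoiding (S := {Pi.single p 1 + Pi.single q 1}) antichainVectors_finite 0
    ⟨inConvexPosition_antichainVectors.singleton_mem (single_add_single_mem hpq hqp), ?_⟩
    fun h => ?_
  · exact fun h => hw0 h.symm
  · obtain ⟨r, hr⟩ := exists_eq_single_of_mem_face h (Set.mem_insert _ _)
      (Set.mem_insert_of_mem _ rfl) hw0
    exact single_add_single_ne_single hne r hr

/-! ### Simplex faces of the order polytope through the origin -/

open scoped Classical in
/-- The indicator vector of the principal filter generated by `p`. -/
noncomputable def principalVector (p : P) : P → ℝ := fun q => if p ≤ q then 1 else 0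

theorem principalVector_eq_one {p q : P} : principalVector p q = 1 ↔ p ≤ q := by
  unfold principalVector; split_ifs with h <;> simp [h]

theorem principalVector_eq_zero {p q : P} : principalVector p q = 0 ↔ ¬p ≤ q := by
  unfold principalVector; split_ifs with h <;> simp [h]

theorem principalVector_injective : Function.Injective (principalVector (P := P)) := by
  intro p q h
  refine le_antisymm ?_ ?_
  · rw [← principalVector_eq_one, h, principalVector_eq_one]
  · rw [← principalVector_eq_one, ← h, principalVector_eq_one]

theorem principalVector_ne_zero (p : P) : principalVector p ≠ 0 := fun h => by
  have h1 : principalVector p p = 1 := principalVector_eq_one.2 le_rfl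
  rw [h] at h1
  exact zero_ne_one h1

theorem mem_filterVectors_of_isUpperSet {s : Set P} (hs : IsUpperSet s) {x : P → ℝ}
    (h1 : ∀ p ∈ s, x p = 1) (h0 : ∀ p ∉ s, x p = 0) : x ∈ filterVectors P := by
  refine ⟨fun p => ?_, fun p q hpq => ?_⟩
  · by_cases h : p ∈ s
    · exact Or.inr (h1 p h)
    · exact Or.inl (h0 p h)
  · by_cases h : p ∈ s
    · rw [h1 p h, h1 q (hs hpq h)]
    · rw [h0 p h]
      by_cases h' : q ∈ s
      · rw [h1 q h']; exact zero_le_one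
      · rw [h0 q h']

theorem principalVector_mem (p : P) : principalVector p ∈ filterVectors P :=
  mem_filterVectors_of_isUpperSet (isUpperSet_Ici p) (fun _ h => principalVector_eq_one.2 h)
    fun _ h => principalVector_eq_zero.2 h

theorem zero_mem_filterVectors : (0 : P → ℝ) ∈ filterVectors P :=
  ⟨fun _ => Or.inl rfl, fun _ _ _ => le_rfl⟩

theorem filterVectors_eq_one_of_le {x : P → ℝ} (hx : x ∈ filterVectors P) {p q : P} (hpq : p ≤ q)
    (hp : x p = 1) : x q = 1 := by
  refine (hx.1 q).resolve_left fun h => ?_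
  have := hx.2 hpq
  rw [hp, h] at this
  exact absurd this (by norm_num)

theorem IsChain.exists_isGreatest_of_finite [Finite P] {c : Set P} (hc : IsChain (· ≤ ·) c)
    (hne : c.Nonempty) : ∃ m, IsGreatest c m := by
  obtain ⟨m, hm⟩ := c.toFinite.exists_maximal hne
  refine ⟨m, hm.prop, fun q hq => ?_⟩
  rcases hc.total hm.prop hq with h | h
  · exact hm.le_of_ge hq h
  · exact h

theorem IsChain.exists_isLeast_of_finite [Finite P] {c : Set P} (hc : IsChain (· ≤ ·) c)
    (hne : c.Nonempty) : ∃ m, IsLeast c m := by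
  obtain ⟨m, hm⟩ := c.toFinite.exists_minimal hne
  refine ⟨m, hm.prop, fun q hq => ?_⟩
  rcases hc.total hm.prop hq with h | h
  · exact h
  · exact hm.le_of_le hq h

/-- The coordinate at the least element `m` of a chain separates the principal filter of `m` from
those of the other elements. -/
theorem affinelyInterpolating_insert_zero_principal [Finite P] (c : Set P)
    (hc : IsChain (· ≤ ·) c) : AffinelyInterpolating (insert 0 (principalVector '' c)) := by
  induction c using WellFoundedLT.induction with
  | ind c ih =>
    rcases c.eq_empty_or_nonempty with rfl | hne
    · simpa using affinelyInterpolating_singleton (0 : P → ℝ)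
    · obtain ⟨m, hm, hle⟩ := hc.exists_isLeast_of_finite hne
      have hlt : c \ {m} < c := Set.sdiff_singleton_ssubset.2 hm
      have h := (ih _ hlt (hc.mono Set.sdiff_subset)).insert (p := principalVector m)
        ⟨(LinearMap.proj m : (P → ℝ) →ₗ[ℝ] ℝ).toAffineMap, ?_, ?_⟩
      · rw [Set.insert_comm, ← Set.image_insert_eq, Set.insert_sdiff_singleton,
          Set.insert_eq_of_mem hm] at h
        exact h
      · rintro _ (rfl | ⟨p, hp, rfl⟩)
        · simp
        · show principalVector p m = 0
          rw [principalVector_eq_zero]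
          exact fun h => hp.2 (le_antisymm h (hle hp.1))
      · show principalVector m m ≠ 0
        rw [principalVector_eq_one.2 le_rfl]
        exact one_ne_zero

/-- The principal filters generated by the elements of a chain span, with the empty filter, a
simplex face of the order polytope. Its equations identify the coordinate at `r` with the one at the
greatest element of the chain below `r`. -/
theorem insert_zero_principal_mem [Finite P] {c : Set P} (hc : IsChain (· ≤ ·) c) :
    insert 0 (principalVector '' c) ∈ simplexFaceSetsThrough (filterVectors P) 0 := by
  refine ⟨⟨?_, affinelyInterpolating_insert_zero_principal c hc⟩, Set.mem_insert _ _⟩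
  have h : CutsOutFace (filterVectors P) {x ∈ filterVectors P |
      ∀ r, (∀ b, IsGreatest {p ∈ c | p ≤ r} b → x r = x b) ∧ ((∀ p ∈ c, ¬p ≤ r) → x r = 0)} := by
    refine cutsOutFace_forall fun r => cutsOutFace_and ?_ ?_
    · exact cutsOutFace_forall fun b => cutsOutFace_imp fun hb =>
        cutsOutFace_apply_eq_apply hb.1.2
    · exact cutsOutFace_imp fun _ => cutsOutFace_apply_eq_zero r
  convert h using 1
  have hex : ∀ {r p : P}, p ∈ c → p ≤ r → ∃ b, IsGreatest {p ∈ c | p ≤ r} b := fun hp hpr =>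
    (hc.mono fun _ h => h.1).exists_isGreatest_of_finite ⟨_, hp, hpr⟩
  ext x
  constructor
  · rintro (rfl | ⟨p, hp, rfl⟩)
    · exact ⟨zero_mem_filterVectors, fun r => ⟨fun b _ => rfl, fun _ => rfl⟩⟩
    · refine ⟨principalVector_mem p, fun r => ⟨fun b hb => ?_, fun hr => ?_⟩⟩
      · by_cases hpr : p ≤ r
        · rw [principalVector_eq_one.2 hpr, principalVector_eq_one.2 (hb.2 ⟨hp, hpr⟩)]
        · rw [principalVector_eq_zero.2 hpr,
            principalVector_eq_zero.2 fun h => hpr (h.trans hb.1.2)]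
      · exact principalVector_eq_zero.2 (hr p hp)
  · rintro ⟨hx, h⟩
    have hone : ∀ r, x r = 1 → ∃ p ∈ c, p ≤ r ∧ x p = 1 := by
      intro r hr
      by_cases hex' : ∃ p ∈ c, p ≤ r
      · obtain ⟨p, hp, hpr⟩ := hex'
        obtain ⟨b, hb⟩ := hex hp hpr
        exact ⟨b, hb.1.1, hb.1.2, by rw [← (h r).1 b hb, hr]⟩
      · push Not at hex'
        rw [(h r).2 hex'] at hr
        exact absurd hr zero_ne_one
    by_cases hx0 : x = 0
    · exact Or.inl hx0
    · right
      obtain ⟨r, hr⟩ : ∃ r, x r = 1 := by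
        by_contra! h
        exact hx0 (funext fun p => (hx.1 p).resolve_right (h p))
      obtain ⟨p, hp, -, hp1⟩ := hone r hr
      obtain ⟨m, ⟨hm, hm1⟩, hle⟩ :=
        IsChain.exists_isLeast_of_finite (c := {p ∈ c | x p = 1}) (hc.mono fun _ h => h.1)
          ⟨p, hp, hp1⟩
      refine ⟨m, hm, ?_⟩
      ext s
      rcases hx.1 s with hs | hs
      · rw [hs, principalVector_eq_zero]
        intro hms
        rw [filterVectors_eq_one_of_le hx hms hm1] at hs
        exact one_ne_zero hs
      · rw [hs, principalVector_eq_one]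
        obtain ⟨t, ht, hts, ht1⟩ := hone s hs
        exact (hle ⟨ht, ht1⟩).trans hts

theorem insert_zero_principal_injective :
    Function.Injective fun c : Set P => insert (0 : P → ℝ) (principalVector '' c) := by
  intro c c' h
  have key : ∀ c : Set P, ∀ p, principalVector p ∈ insert (0 : P → ℝ) (principalVector '' c) ↔
      p ∈ c := by
    intro c p
    rw [Set.mem_insert_iff, principalVector_injective.mem_set_image]
    simp [principalVector_ne_zero]
  ext p
  rw [← key c, ← key c']
  exact Set.ext_iff.1 h _

theorem ncard_chains_le_through [Finite P] : {c : Set P | IsChain (· ≤ ·) c}.ncard ≤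
    (simplexFaceSetsThrough (filterVectors P) 0).ncard :=
  Set.ncard_le_ncard_of_injOn (fun c => insert 0 (principalVector '' c))
    (fun _ hc => insert_zero_principal_mem hc) (insert_zero_principal_injective.injOn)
    ((simplexFaceSets_finite filterVectors_finite).subset fun _ h => h.1)

/-- Two incomparable elements with a common upper bound generate a filter that is joined to the
empty filter by an edge, although it is not principal. -/
theorem ncard_chains_lt_through [Finite P] {d e t : P} (hde : ¬d ≤ e) (hed : ¬e ≤ d) (hd : d ≤ t)
    (he : e ≤ t) : {c : Set P | IsChain (· ≤ ·) c}.ncard <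
      (simplexFaceSetsThrough (filterVectors P) 0).ncard := by
  classical
  set w : P → ℝ := fun r => if d ≤ r ∨ e ≤ r then 1 else 0 with hw
  have hw1 : ∀ r, d ≤ r ∨ e ≤ r → w r = 1 := fun r h => if_pos h
  have hw0 : ∀ r, ¬(d ≤ r ∨ e ≤ r) → w r = 0 := fun r h => if_neg h
  have hwV : w ∈ filterVectors P :=
    mem_filterVectors_of_isUpperSet ((isUpperSet_Ici d).union (isUpperSet_Ici e))
      (fun r h => hw1 r h) fun r h => hw0 r h
  have hface : insert (0 : P → ℝ) {w} ∈ simplexFaceSetsThrough (filterVectors P) 0 := by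
    refine ⟨⟨?_, ?_⟩, Set.mem_insert _ _⟩
    · have h : CutsOutFace (filterVectors P) {x ∈ filterVectors P | ∀ r,
          (¬(d ≤ r ∨ e ≤ r) → x r = 0) ∧ (d ≤ r → x r = x d) ∧ (e ≤ r → x r = x e)} := by
        refine cutsOutFace_forall fun r => cutsOutFace_and ?_ (cutsOutFace_and ?_ ?_)
        · exact cutsOutFace_imp fun _ => cutsOutFace_apply_eq_zero r
        · exact cutsOutFace_imp fun h => cutsOutFace_apply_eq_apply h
        · exact cutsOutFace_imp fun h => cutsOutFace_apply_eq_apply h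
      convert h using 1
      ext x
      constructor
      · rintro (rfl | rfl)
        · exact ⟨zero_mem_filterVectors, fun r => ⟨fun _ => rfl, fun _ => rfl, fun _ => rfl⟩⟩
        · exact ⟨hwV, fun r => ⟨fun h => hw0 r h,
            fun h => by rw [hw1 r (Or.inl h), hw1 d (Or.inl le_rfl)],
            fun h => by rw [hw1 r (Or.inr h), hw1 e (Or.inr le_rfl)]⟩⟩
      · rintro ⟨hx, h⟩
        have hxe : x e = x d := by rw [← (h t).2.1 hd, (h t).2.2 he]
        rcases hx.1 d with h0 | h1
        · left
          ext r
          by_cases hr : d ≤ r ∨ e ≤ r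
          · rcases hr with hr | hr
            · rw [(h r).2.1 hr, h0]; rfl
            · rw [(h r).2.2 hr, hxe, h0]; rfl
          · rw [(h r).1 hr]; rfl
        · right
          show x = w
          ext r
          by_cases hr : d ≤ r ∨ e ≤ r
          · rw [hw1 r hr]
            rcases hr with hr | hr
            · rw [(h r).2.1 hr, h1]
            · rw [(h r).2.2 hr, hxe, h1]
          · rw [(h r).1 hr, hw0 r hr]
    · refine (affinelyInterpolating_singleton w).insert
        ⟨AffineMap.const ℝ _ 1 - (LinearMap.proj d : (P → ℝ) →ₗ[ℝ] ℝ).toAffineMap, ?_, ?_⟩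
      · rintro _ rfl
        simp [hw1 d (Or.inl le_rfl)]
      · simp
  have hnot : insert (0 : P → ℝ) {w} ∉
      (fun c : Set P => insert (0 : P → ℝ) (principalVector '' c)) '' {c | IsChain (· ≤ ·) c} := by
    rintro ⟨c, -, hc⟩
    have hwc : w ∈ insert (0 : P → ℝ) (principalVector '' c) := by
      exact (Set.ext_iff.1 hc w).2 (Set.mem_insert_of_mem _ rfl)
    rcases hwc with h | ⟨p, -, hp⟩
    · have := hw1 d (Or.inl le_rfl)
      rw [h] at this
      exact zero_ne_one this
    · have h1 : p ≤ d := by rw [← principalVector_eq_one, hp, hw1 d (Or.inl le_rfl)]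
      have h2 : p ≤ e := by rw [← principalVector_eq_one, hp, hw1 e (Or.inr le_rfl)]
      have h3 : d ≤ p ∨ e ≤ p := by
        by_contra h
        have h4 := hw0 p h
        rw [← hp, principalVector_eq_one.2 le_rfl] at h4
        exact one_ne_zero h4
      rcases h3 with h3 | h3
      · exact hde (h3.trans h2)
      · exact hed (h3.trans h1)
  rw [← Set.ncard_image_of_injective _ insert_zero_principal_injective]
  refine Set.ncard_lt_ncard ⟨?_, fun h => hnot (h hface)⟩
    ((simplexFaceSets_finite filterVectors_finite).subset fun _ h => h.1)
  rintro _ ⟨c, hc, rfl⟩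
  exact insert_zero_principal_mem hc

/-! ### Duality -/

/-- The affine equivalence `x ↦ 1 - x`, which maps the order polytope of `P` to that of the dual
poset. -/
def dualEquiv (P : Type*) : (P → ℝ) ≃ᵃ[ℝ] (Pᵒᵈ → ℝ) :=
  (AffineEquiv.constVSub ℝ (1 : P → ℝ)).trans
    (LinearEquiv.funCongrLeft ℝ ℝ (OrderDual.ofDual : Pᵒᵈ ≃ P)).toAffineEquiv

theorem dualEquiv_apply {P : Type*} (x : P → ℝ) (p : Pᵒᵈ) :
    dualEquiv P x p = 1 - x (OrderDual.ofDual p) := rfl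

theorem dualEquiv_image_filterVectors :
    dualEquiv P '' filterVectors P = filterVectors Pᵒᵈ := by
  ext y
  constructor
  · rintro ⟨x, hx, rfl⟩
    refine ⟨fun p => ?_, fun p q hpq => ?_⟩
    · rw [dualEquiv_apply]
      rcases hx.1 (OrderDual.ofDual p) with h | h <;> simp [h]
    · rw [dualEquiv_apply, dualEquiv_apply]
      have := hx.2 (OrderDual.ofDual_le_ofDual.2 hpq)
      linarith
  · intro hy
    refine ⟨fun p => 1 - y (OrderDual.toDual p), ⟨fun p => ?_, fun p q hpq => ?_⟩, ?_⟩
    · dsimp only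
      rcases hy.1 (OrderDual.toDual p) with h | h <;> simp [h]
    · dsimp only
      have := hy.2 (OrderDual.toDual_le_toDual.2 hpq)
      linarith
    · ext p
      rw [dualEquiv_apply]
      simp

theorem ncard_through_one_filterVectors :
    (simplexFaceSetsThrough (filterVectors P) 1).ncard =
      (simplexFaceSetsThrough (filterVectors Pᵒᵈ) 0).ncard := by
  have h0 : dualEquiv P 1 = 0 := by
    ext p
    rw [dualEquiv_apply]
    simp
  rw [← dualEquiv_image_filterVectors, ← h0, ncard_through_image]

theorem ncard_chains_orderDual :
    {c : Set Pᵒᵈ | IsChain (· ≤ ·) c}.ncard = {c : Set P | IsChain (· ≤ ·) c}.ncard := by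
  have : {c : Set P | IsChain (· ≤ ·) c} = {c : Set P | IsChain (fun a b : P => b ≤ a) c} := by
    ext c
    exact ⟨fun h => h.symm, fun h => h.symm⟩
  rw [this]
  rfl

theorem ncard_chains_le_through_one [Finite P] : {c : Set P | IsChain (· ≤ ·) c}.ncard ≤
    (simplexFaceSetsThrough (filterVectors P) 1).ncard := by
  have : Finite Pᵒᵈ := ‹Finite P›
  rw [ncard_through_one_filterVectors, ← ncard_chains_orderDual]
  exact ncard_chains_le_through

theorem ncard_chains_lt_through_one [Finite P] {d e t : P} (hde : ¬d ≤ e) (hed : ¬e ≤ d)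
    (hd : t ≤ d) (he : t ≤ e) : {c : Set P | IsChain (· ≤ ·) c}.ncard <
      (simplexFaceSetsThrough (filterVectors P) 1).ncard := by
  have : Finite Pᵒᵈ := ‹Finite P›
  rw [ncard_through_one_filterVectors, ← ncard_chains_orderDual]
  exact ncard_chains_lt_through (P := Pᵒᵈ) (d := OrderDual.toDual d) (e := OrderDual.toDual e)
    (t := OrderDual.toDual t) hed hde hd he

end Chains

/-! ### Copies of `X` -/

section XFree

variable {P : Type u} [PartialOrder P]

/-- `P` contains a copy of the poset `X` with middle element `c`, spelled out in terms of
elements. -/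
def HasX (P : Type u) [PartialOrder P] : Prop :=
  ∃ a b c d e : P, a < c ∧ b < c ∧ c < d ∧ c < e ∧ ¬a ≤ b ∧ ¬b ≤ a ∧ ¬d ≤ e ∧ ¬e ≤ d

theorem not_xFree_iff : ¬XFree P ↔ HasX P := by
  unfold XFree
  rw [not_isEmpty_iff]
  constructor
  · rintro ⟨f⟩
    refine ⟨f (toLex (Sum.inl (Sum.inl ()))), f (toLex (Sum.inl (Sum.inr ()))),
      f (toLex (Sum.inr (toLex (Sum.inl ())))), f (toLex (Sum.inr (toLex (Sum.inr (Sum.inl ()))))),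
      f (toLex (Sum.inr (toLex (Sum.inr (Sum.inr ()))))), ?_⟩
    simp only [f.le_iff_le, f.lt_iff_lt]
    simp
  · rintro ⟨a, b, c, d, e, hac, hbc, hcd, hce, hab, hba, hde, hed⟩
    refine ⟨OrderEmbedding.ofMapLEIff (fun x => Sum.elim (Sum.elim (fun _ => a) (fun _ => b))
      (fun y => Sum.elim (fun _ => c) (Sum.elim (fun _ => d) (fun _ => e)) (ofLex y)) (ofLex x)) ?_⟩
    have had := (hac.trans hcd)
    have hae := (hac.trans hce)
    have hbd := (hbc.trans hcd)
    have hbe := (hbc.trans hce)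
    have hcases : ∀ x : PosetX, x = toLex (Sum.inl (Sum.inl ())) ∨
        x = toLex (Sum.inl (Sum.inr ())) ∨ x = toLex (Sum.inr (toLex (Sum.inl ()))) ∨
        x = toLex (Sum.inr (toLex (Sum.inr (Sum.inl ())))) ∨
        x = toLex (Sum.inr (toLex (Sum.inr (Sum.inr ())))) := by
      rintro ((⟨⟩ | ⟨⟩) | (⟨⟩ | (⟨⟩ | ⟨⟩)))
      · exact Or.inl rfl
      · exact Or.inr (Or.inl rfl)
      · exact Or.inr (Or.inr (Or.inl rfl))
      · exact Or.inr (Or.inr (Or.inr (Or.inl rfl)))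
      · exact Or.inr (Or.inr (Or.inr (Or.inr rfl)))
    intro x y
    rcases hcases x with rfl | rfl | rfl | rfl | rfl <;>
    rcases hcases y with rfl | rfl | rfl | rfl | rfl <;>
    simp [hac.le, hbc.le, hcd.le, hce.le, hab, hba, hde, hed, had.le, hae.le,
      hbd.le, hbe.le, hac.not_ge, hbc.not_ge, hcd.not_ge, hce.not_ge, had.not_ge, hae.not_ge,
      hbd.not_ge, hbe.not_ge]

theorem XFree.isChain_or_isChain (h : XFree P) (p : P) :
    IsChain (· ≤ ·) {q | q < p} ∨ IsChain (· ≤ ·) {q | p < q} := by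
  by_contra! hc
  refine not_xFree_iff.2 ?_ h
  obtain ⟨h1, h2⟩ := hc
  simp only [IsChain, Set.Pairwise, Set.mem_ofPred_eq] at h1 h2
  push Not at h1 h2
  obtain ⟨a, ha, b, hb, -, hab, hba⟩ := h1
  obtain ⟨d, hd, e, he, -, hde, hed⟩ := h2
  exact ⟨a, b, p, d, e, ha, hb, hd, he, hab, hba, hde, hed⟩

theorem XFree.of_orderEmbedding {Q : Type u} [PartialOrder Q] (f : Q ↪o P) (h : XFree P) :
    XFree Q := ⟨fun g => h.false (g.trans f)⟩

theorem HasX.of_sum {A B : Type u} [PartialOrder A] [PartialOrder B] (h : HasX (A ⊕ B)) :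
    HasX A ∨ HasX B := by
  obtain ⟨a, b, c, d, e, hac, hbc, hcd, hce, hab, hba, hde, hed⟩ := h
  rcases c with c | c <;> rcases a with a | a <;> rcases b with b | b <;> rcases d with d | d <;>
    rcases e with e | e <;> simp at hac hbc hcd hce hab hba hde hed
  · exact Or.inl ⟨a, b, c, d, e, hac, hbc, hcd, hce, hab, hba, hde, hed⟩
  · exact Or.inr ⟨a, b, c, d, e, hac, hbc, hcd, hce, hab, hba, hde, hed⟩

/-- A copy of `X` in an ordinal sum lies in one of the summands, or it is cut directly below or
directly above its middle element. -/
theorem HasX.of_ordinalSum {A B : Type u} [PartialOrder A] [PartialOrder B] (h : HasX (A ⊕ₗ B)) :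
    HasX A ∨ HasX B ∨
      (∃ a b : A, ∃ c d e : B, ¬a ≤ b ∧ ¬b ≤ a ∧ c ≤ d ∧ c ≤ e ∧ ¬d ≤ e ∧ ¬e ≤ d) ∨
      (∃ a b c : A, ∃ d e : B, ¬a ≤ b ∧ ¬b ≤ a ∧ a ≤ c ∧ b ≤ c ∧ ¬d ≤ e ∧ ¬e ≤ d) := by
  obtain ⟨a, b, c, d, e, hac, hbc, hcd, hce, hab, hba, hde, hed⟩ := h
  induction a using Lex.rec with | h a => ?_
  induction b using Lex.rec with | h b => ?_
  induction c using Lex.rec with | h c => ?_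
  induction d using Lex.rec with | h d => ?_
  induction e using Lex.rec with | h e => ?_
  rcases c with c | c <;> rcases a with a | a <;> rcases b with b | b <;> rcases d with d | d <;>
    rcases e with e | e <;> simp at hac hbc hcd hce hab hba hde hed
  · exact Or.inl ⟨a, b, c, d, e, hac, hbc, hcd, hce, hab, hba, hde, hed⟩
  · exact Or.inr (Or.inr (Or.inr ⟨a, b, c, d, e, hab, hba, hac.le, hbc.le, hde, hed⟩))
  · exact Or.inr (Or.inr (Or.inl ⟨a, b, c, d, e, hab, hba, hcd.le, hce.le, hde, hed⟩))
  · exact Or.inr (Or.inl ⟨a, b, c, d, e, hac, hbc, hcd, hce, hab, hba, hde, hed⟩)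

end XFree

/-! ### The two polytopes of an `X`-free poset -/

section Equivalence

theorem isChain_le_of_lt {P : Type*} [PartialOrder P] {p : P}
    (hp : IsChain (· ≤ ·) {q | q < p}) : IsChain (· ≤ ·) {q | q ≤ p} := by
  have : {q | q ≤ p} = insert p {q | q < p} := by
    ext q; simp [le_iff_eq_or_lt]
  rw [this]
  exact hp.insert fun q (hq : q < p) _ => Or.inr hq.le

theorem isChain_ge_of_gt {P : Type*} [PartialOrder P] {p : P}
    (hp : IsChain (· ≤ ·) {q | p < q}) : IsChain (· ≤ ·) {q | p ≤ q} := by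
  have : {q | p ≤ q} = insert p {q | p < q} := by
    ext q; simp [le_iff_eq_or_lt, eq_comm]
  rw [this]
  exact hp.insert fun q (hq : p < q) _ => Or.inl hq.le

open scoped Classical

variable {P : Type u} [PartialOrder P] [Fintype P]

/-- The sum of the coordinates at the elements below `p`. -/
noncomputable def sumBelow (y : P → ℝ) (p : P) : ℝ :=
  ∑ q ∈ Finset.univ.filter (· ≤ p), y q

/-- The sum of the coordinates at the elements above `p`. -/
noncomputable def sumAbove (y : P → ℝ) (p : P) : ℝ :=
  ∑ q ∈ Finset.univ.filter (p ≤ ·), y q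

theorem sum_le_sumBelow {y : P → ℝ} (hy : ∀ p, 0 ≤ y p) {s : Finset P} {p : P}
    (h : ∀ q ∈ s, q ≤ p) : ∑ q ∈ s, y q ≤ sumBelow y p :=
  Finset.sum_le_sum_of_subset_of_nonneg (fun q hq => by simpa using h q hq) fun q _ _ => hy q

theorem sum_le_sumAbove {y : P → ℝ} (hy : ∀ p, 0 ≤ y p) {s : Finset P} {p : P}
    (h : ∀ q ∈ s, p ≤ q) : ∑ q ∈ s, y q ≤ sumAbove y p :=
  Finset.sum_le_sum_of_subset_of_nonneg (fun q hq => by simpa using h q hq) fun q _ _ => hy q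

theorem sumBelow_eq_of_lt {y : P → ℝ} {p : P} : sumBelow y p =
    y p + ∑ q ∈ Finset.univ.filter (· < p), y q := by
  unfold sumBelow
  rw [← Finset.sum_insert (s := Finset.univ.filter (· < p)) (by simp)]
  refine Finset.sum_congr ?_ fun _ _ => rfl
  ext q
  simp [le_iff_eq_or_lt]

theorem sumAbove_eq_of_lt {y : P → ℝ} {p : P} : sumAbove y p =
    y p + ∑ q ∈ Finset.univ.filter (p < ·), y q := by
  unfold sumAbove
  rw [← Finset.sum_insert (s := Finset.univ.filter (p < ·)) (by simp)]
  refine Finset.sum_congr ?_ fun _ _ => rfl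
  ext q
  simp [le_iff_eq_or_lt, eq_comm]

/-- The linear part of `chainToOrder`. -/
noncomputable def chainToOrderLinear (P : Type u) [PartialOrder P] [Fintype P] :
    (P → ℝ) →ₗ[ℝ] (P → ℝ) where
  toFun y p := if IsChain (· ≤ ·) {q | q < p} then sumBelow y p else -sumAbove y p
  map_add' y z := by
    ext p
    simp only [sumBelow, sumAbove, Pi.add_apply, Finset.sum_add_distrib]
    split_ifs
    · rfl
    · ring
  map_smul' r y := by
    ext p
    simp only [sumBelow, sumAbove, Pi.smul_apply, smul_eq_mul, ← Finset.mul_sum, RingHom.id_apply]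
    split_ifs
    · rfl
    · ring

theorem chainToOrderLinear_injective : Function.Injective (chainToOrderLinear P) := by
  rw [← LinearMap.ker_eq_bot, LinearMap.ker_eq_bot']
  intro y hy
  have happ : ∀ p, (if IsChain (· ≤ ·) {q | q < p} then sumBelow y p else -sumAbove y p) = 0 :=
    fun p => congrFun hy p
  -- the system is triangular: upwards on the elements whose lower set is a chain, and downwards on
  -- the others
  have hL : ∀ p, IsChain (· ≤ ·) {q | q < p} → y p = 0 := by
    intro p
    induction p using WellFoundedLT.induction with
    | ind p ih =>
      intro hp
      have h := happ p
      rw [if_pos hp, sumBelow_eq_of_lt, Finset.sum_eq_zero, add_zero] at h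
      · exact h
      · intro q hq
        have hq : q < p := by simpa using hq
        exact ih q hq (hp.mono fun r (hr : r < q) => hr.trans hq)
  have hU : ∀ p, ¬IsChain (· ≤ ·) {q | q < p} → y p = 0 := by
    intro p
    induction p using WellFoundedGT.induction with
    | ind p ih =>
      intro hp
      have h := happ p
      rw [if_neg hp, sumAbove_eq_of_lt, Finset.sum_eq_zero, add_zero, neg_eq_zero] at h
      · exact h
      · intro q hq
        have hq : p < q := by simpa using hq
        exact ih q hq fun hc => hp (hc.mono fun r (hr : r < p) => hr.trans hq)
  ext p
  by_cases h : IsChain (· ≤ ·) {q | q < p}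
  · exact hL p h
  · exact hU p h

/-- The affine equivalence that maps the chain polytope of an `X`-free poset to its order polytope:
the coordinate at `p` is the sum of the coordinates below `p`, if the elements below `p` form a
chain, and `1` minus the sum of the coordinates above `p` otherwise. -/
noncomputable def chainToOrder (P : Type u) [PartialOrder P] [Fintype P] :
    (P → ℝ) ≃ᵃ[ℝ] (P → ℝ) :=
  (LinearEquiv.ofInjectiveEndo (chainToOrderLinear P)
    chainToOrderLinear_injective).toAffineEquiv.trans
    (AffineEquiv.constVAdd ℝ (P → ℝ) fun p => if IsChain (· ≤ ·) {q | q < p} then 0 else 1)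

theorem chainToOrder_of_isChain {p : P} (hp : IsChain (· ≤ ·) {q | q < p}) (y : P → ℝ) :
    chainToOrder P y p = sumBelow y p := by
  have : chainToOrder P y p = (if IsChain (· ≤ ·) {q | q < p} then 0 else 1) +
    (if IsChain (· ≤ ·) {q | q < p} then sumBelow y p else -sumAbove y p) := rfl
  rw [this, if_pos hp, if_pos hp, zero_add]

theorem chainToOrder_of_not_isChain {p : P} (hp : ¬IsChain (· ≤ ·) {q | q < p}) (y : P → ℝ) :
    chainToOrder P y p = 1 - sumAbove y p := by
  have : chainToOrder P y p = (if IsChain (· ≤ ·) {q | q < p} then 0 else 1) +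
    (if IsChain (· ≤ ·) {q | q < p} then sumBelow y p else -sumAbove y p) := rfl
  rw [this, if_neg hp, if_neg hp, sub_eq_add_neg]

theorem chainToOrder_mem_orderPolytope (hX : XFree P) {y : P → ℝ} (hy : y ∈ chainPolytope P) :
    chainToOrder P y ∈ orderPolytope P := by
  obtain ⟨h0, hc⟩ := hy
  have hS : ∀ p, IsChain (· ≤ ·) {q | q < p} → sumBelow y p ≤ 1 := fun p hp =>
    hc _ (by simpa using isChain_le_of_lt hp)
  have hU : ∀ p, ¬IsChain (· ≤ ·) {q | q < p} → IsChain (· ≤ ·) {q | p ≤ q} := fun p hp =>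
    isChain_ge_of_gt ((hX.isChain_or_isChain p).resolve_left hp)
  have hD : ∀ p, ¬IsChain (· ≤ ·) {q | q < p} → sumAbove y p ≤ 1 := fun p hp =>
    hc _ (by simpa using hU p hp)
  have hS0 : ∀ p, 0 ≤ sumBelow y p := fun p => Finset.sum_nonneg fun q _ => h0 q
  have hD0 : ∀ p, 0 ≤ sumAbove y p := fun p => Finset.sum_nonneg fun q _ => h0 q
  refine ⟨fun p => ?_, fun p q hpq => ?_⟩
  · by_cases hp : IsChain (· ≤ ·) {q | q < p}
    · rw [chainToOrder_of_isChain hp]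
      exact ⟨hS0 p, hS p hp⟩
    · rw [chainToOrder_of_not_isChain hp]
      exact ⟨sub_nonneg.2 (hD p hp), sub_le_self _ (hD0 p)⟩
  · by_cases hp : IsChain (· ≤ ·) {r | r < p} <;> by_cases hq : IsChain (· ≤ ·) {r | r < q}
    · rw [chainToOrder_of_isChain hp, chainToOrder_of_isChain hq]
      exact sum_le_sumBelow h0 fun r hr => (by simpa using hr : r ≤ p).trans hpq
    · rw [chainToOrder_of_isChain hp, chainToOrder_of_not_isChain hq, le_sub_iff_add_le]
      unfold sumBelow sumAbove
      rw [← Finset.sum_union]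
      · refine hc _ ?_
        have hL := isChain_le_of_lt hp
        have hR := hU q hq
        intro r hr s hs hrs
        simp only [Finset.coe_union, Finset.coe_filter, Finset.mem_univ, true_and,
          Set.mem_union, Set.mem_ofPred_eq] at hr hs
        rcases hr with hr | hr <;> rcases hs with hs | hs
        · exact hL hr hs hrs
        · exact Or.inl (hr.trans (hpq.trans hs))
        · exact Or.inr (hs.trans (hpq.trans hr))
        · exact hR hr hs hrs
      · rw [Finset.disjoint_left]
        intro r hr hr'
        simp only [Finset.mem_filter, Finset.mem_univ, true_and] at hr hr'
        exact hq (le_antisymm hpq (hr'.trans hr) ▸ hp)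
    · exact absurd (hq.mono fun r (hr : r < p) => hr.trans_le hpq) hp
    · rw [chainToOrder_of_not_isChain hp, chainToOrder_of_not_isChain hq]
      exact sub_le_sub_left
        (sum_le_sumAbove h0 fun r hr => hpq.trans (by simpa using hr : q ≤ r)) _

theorem mem_chainPolytope_of_chainToOrder (hX : XFree P) {y : P → ℝ}
    (hy : chainToOrder P y ∈ orderPolytope P) : y ∈ chainPolytope P := by
  obtain ⟨h01, hm⟩ := hy
  have h0 : ∀ p, 0 ≤ y p := by
    intro p
    by_cases hp : IsChain (· ≤ ·) {q | q < p}
    · have hxp := chainToOrder_of_isChain hp y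
      rw [sumBelow_eq_of_lt] at hxp
      rcases ({q | q < p} : Set P).eq_empty_or_nonempty with he | hne
      · have : Finset.univ.filter (· < p) = ∅ := by
          ext q
          simpa using Set.ext_iff.1 he q
        rw [this, Finset.sum_empty, add_zero] at hxp
        rw [← hxp]
        exact (h01 p).1
      · obtain ⟨m, hm', hmax⟩ := hp.exists_isGreatest_of_finite hne
        have hm' : m < p := hm'
        have hmL : IsChain (· ≤ ·) {q | q < m} := hp.mono fun q (hq : q < m) => hq.trans hm'
        have : Finset.univ.filter (· < p) = Finset.univ.filter (· ≤ m) := by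
          ext q
          simp only [Finset.mem_filter, Finset.mem_univ, true_and]
          exact ⟨fun h => hmax h, fun h => h.trans_lt hm'⟩
        rw [this] at hxp
        have h1 := hm m p hm'.le
        rw [hxp, chainToOrder_of_isChain hmL] at h1
        unfold sumBelow at h1
        linarith
    · have hxp := chainToOrder_of_not_isChain hp y
      have hpU := (hX.isChain_or_isChain p).resolve_left hp
      rw [sumAbove_eq_of_lt] at hxp
      rcases ({q | p < q} : Set P).eq_empty_or_nonempty with he | hne
      · have : Finset.univ.filter (p < ·) = ∅ := by
          ext q
          simpa using Set.ext_iff.1 he q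
        rw [this, Finset.sum_empty, add_zero] at hxp
        have := (h01 p).2
        linarith
      · obtain ⟨m, hm', hmin⟩ := hpU.exists_isLeast_of_finite hne
        have hm' : p < m := hm'
        have hmU : ¬IsChain (· ≤ ·) {q | q < m} := fun h =>
          hp (h.mono fun q (hq : q < p) => hq.trans hm')
        have : Finset.univ.filter (p < ·) = Finset.univ.filter (m ≤ ·) := by
          ext q
          simp only [Finset.mem_filter, Finset.mem_univ, true_and]
          exact ⟨fun h => hmin h, fun h => hm'.trans_le h⟩
        rw [this] at hxp
        have h1 := hm p m hm'.le
        rw [hxp, chainToOrder_of_not_isChain hmU] at h1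
        unfold sumAbove at h1
        linarith
  refine ⟨h0, fun c hc => ?_⟩
  rw [← Finset.sum_filter_add_sum_filter_not c fun p => IsChain (· ≤ ·) {q | q < p}]
  set L := c.filter fun p => IsChain (· ≤ ·) {q | q < p} with hL
  set U := c.filter fun p => ¬IsChain (· ≤ ·) {q | q < p} with hU
  have hcL : IsChain (· ≤ ·) (L : Set P) := hc.mono fun _ h => (Finset.mem_filter.1 h).1
  have hcU : IsChain (· ≤ ·) (U : Set P) := hc.mono fun _ h => (Finset.mem_filter.1 h).1
  have eL : L.Nonempty → ∃ m ∈ L, ∑ p ∈ L, y p ≤ chainToOrder P y m := by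
    intro hne
    obtain ⟨m, hmL, hmax⟩ := hcL.exists_isGreatest_of_finite (by simpa using hne)
    refine ⟨m, hmL, ?_⟩
    rw [chainToOrder_of_isChain (Finset.mem_filter.1 hmL).2]
    exact sum_le_sumBelow h0 fun q hq => hmax hq
  have eU : U.Nonempty → ∃ m ∈ U, ∑ p ∈ U, y p ≤ 1 - chainToOrder P y m := by
    intro hne
    obtain ⟨m, hmU, hmin⟩ := hcU.exists_isLeast_of_finite (by simpa using hne)
    refine ⟨m, hmU, ?_⟩
    rw [chainToOrder_of_not_isChain (Finset.mem_filter.1 hmU).2, sub_sub_cancel]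
    exact sum_le_sumAbove h0 fun q hq => hmin hq
  rcases L.eq_empty_or_nonempty with hL0 | hLne
  · rw [hL0, Finset.sum_empty, zero_add]
    rcases U.eq_empty_or_nonempty with hU0 | hUne
    · rw [hU0, Finset.sum_empty]; exact zero_le_one
    · obtain ⟨m, -, hle⟩ := eU hUne
      exact hle.trans (sub_le_self _ (h01 m).1)
  · obtain ⟨m, hmL, hle⟩ := eL hLne
    rcases U.eq_empty_or_nonempty with hU0 | hUne
    · rw [hU0, Finset.sum_empty, add_zero]
      exact hle.trans (h01 m).2
    · obtain ⟨m', hmU, hle'⟩ := eU hUne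
      have hmL' := Finset.mem_filter.1 hmL
      have hmU' := Finset.mem_filter.1 hmU
      have hmm : m ≤ m' := by
        rcases hc.total (Finset.mem_coe.2 hmL'.1) (Finset.mem_coe.2 hmU'.1) with h | h
        · exact h
        · exact absurd (hmL'.2.mono fun r (hr : r < m') => hr.trans_le h) hmU'.2
      have := hm m m' hmm
      linarith

theorem chainToOrder_image (hX : XFree P) :
    chainToOrder P '' chainPolytope P = orderPolytope P := by
  ext x
  constructor
  · rintro ⟨y, hy, rfl⟩
    exact chainToOrder_mem_orderPolytope hX hy
  · intro hx
    obtain ⟨y, rfl⟩ := (chainToOrder P).surjective x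
    exact ⟨y, mem_chainPolytope_of_chainToOrder hX hx, rfl⟩

end Equivalence

theorem XFree.simplexPoly_eq {P : Type u} [PartialOrder P] [Finite P] (h : XFree P) :
    simplexPoly (orderPolytope P) = simplexPoly (chainPolytope P) := by
  have := Fintype.ofFinite P
  rw [← chainToOrder_image h, simplexPoly_image]

/-! ### Vertices of the polytopes of sums of posets -/

section Sums

theorem AffineEquiv.image_eq_of_mem_iff {E F : Type*} [AddCommGroup E] [Module ℝ E]
    [AddCommGroup F] [Module ℝ F] (e : E ≃ᵃ[ℝ] F) {S : Set E} {T : Set F}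
    (h : ∀ x, e x ∈ T ↔ x ∈ S) : e '' S = T := by
  ext y
  obtain ⟨x, rfl⟩ := e.surjective y
  rw [e.injective.mem_set_image, h]

variable {A B : Type u}

/-- Restriction of vectors to the two summands of a disjoint union. -/
def sumEquiv (A B : Type u) : (A ⊕ B → ℝ) ≃ᵃ[ℝ] (A → ℝ) × (B → ℝ) :=
  (LinearEquiv.sumArrowLequivProdArrow A B ℝ ℝ).toAffineEquiv

/-- Restriction of vectors to the two summands of an ordinal sum. -/
def lexSumEquiv (A B : Type u) : (A ⊕ₗ B → ℝ) ≃ᵃ[ℝ] (A → ℝ) × (B → ℝ) :=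
  ((LinearEquiv.funCongrLeft ℝ ℝ (toLex : A ⊕ B ≃ A ⊕ₗ B)).trans
    (LinearEquiv.sumArrowLequivProdArrow A B ℝ ℝ)).toAffineEquiv

/-- Transport of vectors along an equivalence of index types. -/
def reindexEquiv (e : A ≃ B) : (A → ℝ) ≃ᵃ[ℝ] (B → ℝ) :=
  (LinearEquiv.funCongrLeft ℝ ℝ e.symm).toAffineEquiv

theorem sumEquiv_apply (x : A ⊕ B → ℝ) :
    sumEquiv A B x = (fun a => x (Sum.inl a), fun b => x (Sum.inr b)) := rfl

theorem lexSumEquiv_apply (x : A ⊕ₗ B → ℝ) :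
    lexSumEquiv A B x = (fun a => x (toLex (Sum.inl a)), fun b => x (toLex (Sum.inr b))) := rfl

theorem reindexEquiv_apply (e : A ≃ B) (x : A → ℝ) : reindexEquiv e x = x ∘ e.symm := rfl

variable [PartialOrder A] [PartialOrder B]

theorem reindexEquiv_image_filterVectors (e : A ≃o B) :
    reindexEquiv e.toEquiv '' filterVectors A = filterVectors B := by
  refine AffineEquiv.image_eq_of_mem_iff _ fun x => ?_
  rw [reindexEquiv_apply]
  constructor
  · rintro ⟨h, hm⟩
    exact ⟨fun p => by simpa using h (e p), fun p q hpq => by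
      simpa using hm (e.le_iff_le.2 hpq)⟩
  · rintro ⟨h, hm⟩
    exact ⟨fun p => h _, fun p q hpq => hm (e.symm.le_iff_le.2 hpq)⟩

theorem reindexEquiv_image_antichainVectors (e : A ≃o B) :
    reindexEquiv e.toEquiv '' antichainVectors A = antichainVectors B := by
  refine AffineEquiv.image_eq_of_mem_iff _ fun x => ?_
  rw [reindexEquiv_apply]
  constructor
  · rintro ⟨h, hm⟩
    exact ⟨fun p => by simpa using h (e p), fun p q hpq => by
      simpa using hm (e p) (e q) (e.lt_iff_lt.2 hpq)⟩
  · rintro ⟨h, hm⟩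
    exact ⟨fun p => h _, fun p q hpq => hm _ _ (e.symm.lt_iff_lt.2 hpq)⟩

theorem sumEquiv_image_filterVectors :
    sumEquiv A B '' filterVectors (A ⊕ B) = filterVectors A ×ˢ filterVectors B := by
  refine AffineEquiv.image_eq_of_mem_iff _ fun x => ?_
  rw [sumEquiv_apply]
  constructor
  · rintro ⟨⟨h1, m1⟩, ⟨h2, m2⟩⟩
    refine ⟨?_, ?_⟩
    · rintro (a | b)
      · exact h1 a
      · exact h2 b
    · rintro (a | b) (a' | b') h
      · exact m1 (Sum.inl_le_inl_iff.1 h)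
      · exact absurd h Sum.not_inl_le_inr
      · exact absurd h Sum.not_inr_le_inl
      · exact m2 (Sum.inr_le_inr_iff.1 h)
  · rintro ⟨h, m⟩
    exact ⟨⟨fun a => h _, fun a a' haa => m (Sum.inl_le_inl_iff.2 haa)⟩,
      ⟨fun b => h _, fun b b' hbb => m (Sum.inr_le_inr_iff.2 hbb)⟩⟩

theorem sumEquiv_image_antichainVectors :
    sumEquiv A B '' antichainVectors (A ⊕ B) = antichainVectors A ×ˢ antichainVectors B := by
  refine AffineEquiv.image_eq_of_mem_iff _ fun x => ?_
  rw [sumEquiv_apply]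
  constructor
  · rintro ⟨⟨h1, m1⟩, ⟨h2, m2⟩⟩
    refine ⟨?_, ?_⟩
    · rintro (a | b)
      · exact h1 a
      · exact h2 b
    · rintro (a | b) (a' | b') h
      · exact m1 _ _ (Sum.inl_lt_inl_iff.1 h)
      · exact absurd h Sum.not_inl_lt_inr
      · exact absurd h Sum.not_inr_lt_inl
      · exact m2 _ _ (Sum.inr_lt_inr_iff.1 h)
  · rintro ⟨h, m⟩
    exact ⟨⟨fun a => h _, fun a a' haa => m _ _ (Sum.inl_lt_inl_iff.2 haa)⟩,
      ⟨fun b => h _, fun b b' hbb => m _ _ (Sum.inr_lt_inr_iff.2 hbb)⟩⟩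

theorem one_mem_filterVectors : (1 : A → ℝ) ∈ filterVectors A :=
  ⟨fun _ => Or.inr rfl, fun _ _ _ => le_rfl⟩

theorem zero_mem_antichainVectors : (0 : A → ℝ) ∈ antichainVectors A :=
  ⟨fun _ => Or.inl rfl, fun _ _ _ => Or.inl rfl⟩

/-- A filter of an ordinal sum is a filter of the upper part, or it contains the whole upper
part. -/
theorem lexSumEquiv_image_filterVectors :
    lexSumEquiv A B '' filterVectors (A ⊕ₗ B) = wedge (filterVectors A) (filterVectors B) 0 1 := by
  refine AffineEquiv.image_eq_of_mem_iff _ fun x => ?_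
  rw [lexSumEquiv_apply]
  constructor
  · intro hx
    have hA : (fun a => x (toLex (Sum.inl a))) ∈ filterVectors A := by
      rcases hx with ⟨h, -⟩ | ⟨h, -⟩
      · exact h
      · have h : (fun a => x (toLex (Sum.inl a))) = 0 := h
        rw [h]; exact zero_mem_filterVectors
    have hB : (fun b => x (toLex (Sum.inr b))) ∈ filterVectors B := by
      rcases hx with ⟨-, h⟩ | ⟨-, h⟩
      · have h : (fun b => x (toLex (Sum.inr b))) = 1 := h
        rw [h]; exact one_mem_filterVectors
      · exact h
    have hAB : ∀ a b, x (toLex (Sum.inl a)) ≤ x (toLex (Sum.inr b)) := by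
      intro a b
      rcases hx with ⟨-, h⟩ | ⟨h, -⟩
      · have hb : x (toLex (Sum.inr b)) = 1 := congrFun h b
        rw [hb]
        rcases hA.1 a with h | h <;> dsimp only at h <;> rw [h]
        exact zero_le_one
      · have ha : x (toLex (Sum.inl a)) = 0 := congrFun h a
        rw [ha]
        rcases hB.1 b with h | h <;> dsimp only at h <;> rw [h]
        exact zero_le_one
    refine ⟨?_, ?_⟩
    · rintro (a | b)
      · exact hA.1 a
      · exact hB.1 b
    · rintro (a | b) (a' | b') h
      · exact hA.2 (Sum.Lex.inl_le_inl_iff.1 h)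
      · exact hAB a b'
      · exact absurd h Sum.Lex.not_inr_le_inl
      · exact hB.2 (Sum.Lex.inr_le_inr_iff.1 h)
  · rintro ⟨h, m⟩
    have hA : (fun a => x (toLex (Sum.inl a))) ∈ filterVectors A :=
      ⟨fun a => h _, fun a a' haa => m (Sum.Lex.inl_le_inl_iff.2 haa)⟩
    have hB : (fun b => x (toLex (Sum.inr b))) ∈ filterVectors B :=
      ⟨fun b => h _, fun b b' hbb => m (Sum.Lex.inr_le_inr_iff.2 hbb)⟩
    by_cases hb : ∃ b, x (toLex (Sum.inr b)) = 0
    · obtain ⟨b, hb⟩ := hb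
      refine Or.inr ⟨funext fun a => ?_, hB⟩
      have := m (Sum.Lex.inl_le_inr a b)
      rw [hb] at this
      rcases h (toLex (Sum.inl a)) with h | h
      · exact h
      · rw [h] at this
        exact absurd this (by norm_num)
    · push Not at hb
      exact Or.inl ⟨hA, funext fun b => (h _).resolve_left (hb b)⟩

theorem lexSumEquiv_image_antichainVectors :
    lexSumEquiv A B '' antichainVectors (A ⊕ₗ B) =
      wedge (antichainVectors A) (antichainVectors B) 0 0 := by
  refine AffineEquiv.image_eq_of_mem_iff _ fun x => ?_
  rw [lexSumEquiv_apply]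
  constructor
  · intro hx
    have hA : (fun a => x (toLex (Sum.inl a))) ∈ antichainVectors A := by
      rcases hx with ⟨h, -⟩ | ⟨h, -⟩
      · exact h
      · have h : (fun a => x (toLex (Sum.inl a))) = 0 := h
        rw [h]; exact zero_mem_antichainVectors
    have hB : (fun b => x (toLex (Sum.inr b))) ∈ antichainVectors B := by
      rcases hx with ⟨-, h⟩ | ⟨-, h⟩
      · have h : (fun b => x (toLex (Sum.inr b))) = 0 := h
        rw [h]; exact zero_mem_antichainVectors
      · exact h
    have hAB : ∀ a b, x (toLex (Sum.inl a)) = 0 ∨ x (toLex (Sum.inr b)) = 0 := by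
      intro a b
      rcases hx with ⟨-, h⟩ | ⟨h, -⟩
      · exact Or.inr (congrFun h b)
      · exact Or.inl (congrFun h a)
    refine ⟨?_, ?_⟩
    · rintro (a | b)
      · exact hA.1 a
      · exact hB.1 b
    · rintro (a | b) (a' | b') h
      · exact hA.2 _ _ (Sum.Lex.inl_lt_inl_iff.1 h)
      · exact hAB a b'
      · exact absurd h Sum.Lex.not_inr_lt_inl
      · exact hB.2 _ _ (Sum.Lex.inr_lt_inr_iff.1 h)
  · rintro ⟨h, m⟩
    have hA : (fun a => x (toLex (Sum.inl a))) ∈ antichainVectors A :=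
      ⟨fun a => h _, fun a a' haa => m _ _ (Sum.Lex.inl_lt_inl_iff.2 haa)⟩
    have hB : (fun b => x (toLex (Sum.inr b))) ∈ antichainVectors B :=
      ⟨fun b => h _, fun b b' hbb => m _ _ (Sum.Lex.inr_lt_inr_iff.2 hbb)⟩
    by_cases hb : ∃ b, x (toLex (Sum.inr b)) ≠ 0
    · obtain ⟨b, hb⟩ := hb
      exact Or.inr ⟨funext fun a => (m _ _ (Sum.Lex.inl_lt_inr a b)).resolve_right hb, hB⟩
    · push Not at hb
      exact Or.inl ⟨hA, funext hb⟩

theorem ncard_simplexFaceSets_filterVectors_lex [Finite A] [Finite B] :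
    (simplexFaceSets (filterVectors (A ⊕ₗ B))).ncard =
      (simplexFaceSetsThrough (filterVectors A) 0).ncard *
        (simplexFaceSetsThrough (filterVectors B) 1).ncard +
      (simplexFaceSetsAvoiding (filterVectors A) 0).ncard *
        (simplexFaceSetsAvoiding (filterVectors B) 1).ncard := by
  rw [← ncard_simplexFaceSets_image (lexSumEquiv A B), lexSumEquiv_image_filterVectors]
  exact ncard_simplexFaceSets_wedge filterVectors_finite filterVectors_finite
    zero_mem_filterVectors one_mem_filterVectors

theorem ncard_simplexFaceSets_antichainVectors_lex [Finite A] [Finite B] :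
    (simplexFaceSets (antichainVectors (A ⊕ₗ B))).ncard =
      (simplexFaceSetsThrough (antichainVectors A) 0).ncard *
        (simplexFaceSetsThrough (antichainVectors B) 0).ncard +
      (simplexFaceSetsAvoiding (antichainVectors A) 0).ncard *
        (simplexFaceSetsAvoiding (antichainVectors B) 0).ncard := by
  rw [← ncard_simplexFaceSets_image (lexSumEquiv A B), lexSumEquiv_image_antichainVectors]
  exact ncard_simplexFaceSets_wedge antichainVectors_finite antichainVectors_finite
    zero_mem_antichainVectors zero_mem_antichainVectors

end Sums

/-! ### Comparison of the two counts -/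

/-- The numbers of simplex faces through (`y`, `z`) and avoiding (`n`, `m`) the glued vertices
enter the count of a wedge as `2 (y z + n m) = (y + n) (z + m) + (n - y) (m - z)`, so that fewer
faces through the vertices and more faces in total make the count larger. -/
theorem wedge_count_le_and_lt {y n y' n' z m z' m' : ℕ} (h : y + n ≤ y' + n') (hy : y' ≤ y)
    (hyn : y ≤ n) (k : z + m ≤ z' + m') (kz : z' ≤ z) (kzm : z ≤ m) (hpos : 0 < y + n)
    (kpos : 0 < z + m) :
    y * z + n * m ≤ y' * z' + n' * m' ∧
      ((y + n < y' + n' ∨ z + m < z' + m' ∨ (y' < n' ∧ z' < z) ∨ (y' < y ∧ z' < m')) →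
        y * z + n * m < y' * z' + n' * m') := by
  obtain ⟨d, rfl⟩ := Nat.exists_eq_add_of_le hyn
  obtain ⟨e, rfl⟩ := Nat.exists_eq_add_of_le kzm
  obtain ⟨d', rfl⟩ := Nat.exists_eq_add_of_le (show y' ≤ n' by omega)
  obtain ⟨e', rfl⟩ := Nat.exists_eq_add_of_le (show z' ≤ m' by omega)
  have hd : d ≤ d' := by omega
  have he : e ≤ e' := by omega
  have id1 : 2 * (y * z + (y + d) * (z + e)) =
      (y + (y + d)) * (z + (z + e)) + d * e := by ring
  have id2 : 2 * (y' * z' + (y' + d') * (z' + e')) =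
      (y' + (y' + d')) * (z' + (z' + e')) + d' * e' := by ring
  have hs := Nat.mul_le_mul h k
  have hde := Nat.mul_le_mul hd he
  refine ⟨by omega, ?_⟩
  rintro (hlt | hlt | ⟨h1, h2⟩ | ⟨h1, h2⟩)
  · have := Nat.mul_lt_mul_of_lt_of_le hlt k (kpos.trans_le k)
    omega
  · have := Nat.mul_lt_mul_of_le_of_lt h hlt (hpos.trans_le h)
    omega
  · have h3 : d * e < d' * e' := (Nat.mul_le_mul_right e hd).trans_lt
      (Nat.mul_lt_mul_of_pos_left (by omega) (by omega))
    omega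
  · have h3 : d * e < d' * e' := (Nat.mul_le_mul_left d he).trans_lt
      (Nat.mul_lt_mul_of_pos_right (by omega) (by omega))
    omega

theorem ncard_simplexFaceSets_pos {E : Type*} [AddCommGroup E] [Module ℝ E] {V : Set E}
    (hV : V.Finite) : 0 < (simplexFaceSets V).ncard :=
  (Set.ncard_pos (simplexFaceSets_finite hV)).2 ⟨∅, empty_mem_simplexFaceSets V⟩

/-- For posets of the family, the order polytope has at most as many simplex faces as the chain
polytope, and fewer if the poset contains a copy of `X`. -/
theorem InFamilyF.ncard_simplexFaceSets_le {P : Type u} [PartialOrder P] (hP : InFamilyF P) :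
    Finite P ∧
      (simplexFaceSets (filterVectors P)).ncard ≤ (simplexFaceSets (antichainVectors P)).ncard ∧
      (HasX P → (simplexFaceSets (filterVectors P)).ncard <
        (simplexFaceSets (antichainVectors P)).ncard) := by
  induction hP with
  | xFree P hfree =>
    refine ⟨‹_›, le_of_eq ?_, fun h => absurd hfree (not_xFree_iff.2 h)⟩
    have h := congrArg (Polynomial.eval 1) hfree.simplexPoly_eq
    rwa [eval_one_simplexPoly_orderPolytope, eval_one_simplexPoly_chainPolytope] at h
  | disjointUnion A B _ _ hA hB =>
    obtain ⟨fA, leA, ltA⟩ := hA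
    obtain ⟨fB, leB, ltB⟩ := hB
    have hO := ncard_simplexFaceSets_prod (V := filterVectors A) (W := filterVectors B)
      filterVectors_finite filterVectors_finite inConvexPosition_filterVectors
      inConvexPosition_filterVectors
    have hC := ncard_simplexFaceSets_prod (V := antichainVectors A) (W := antichainVectors B)
      antichainVectors_finite antichainVectors_finite inConvexPosition_antichainVectors
      inConvexPosition_antichainVectors
    rw [← sumEquiv_image_filterVectors, ncard_simplexFaceSets_image,
      ncard_filterVectors_eq (P := A), ncard_filterVectors_eq (P := B)] at hO
    rw [← sumEquiv_image_antichainVectors, ncard_simplexFaceSets_image] at hC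
    have pA : 0 < (antichainVectors A).ncard :=
      (Set.ncard_pos antichainVectors_finite).2 ⟨0, zero_mem_antichainVectors⟩
    have pB : 0 < (antichainVectors B).ncard :=
      (Set.ncard_pos antichainVectors_finite).2 ⟨0, zero_mem_antichainVectors⟩
    have mA := Nat.mul_le_mul_left (antichainVectors B).ncard leA
    have mB := Nat.mul_le_mul_left (antichainVectors A).ncard leB
    refine ⟨inferInstance, by omega, fun h => ?_⟩
    rcases h.of_sum with h | h
    · have := Nat.mul_lt_mul_of_pos_left (ltA h) pB
      omega
    · have := Nat.mul_lt_mul_of_pos_left (ltB h) pA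
      omega
  | ordinalSum A B _ _ hA hB =>
    obtain ⟨fA, leA, ltA⟩ := hA
    obtain ⟨fB, leB, ltB⟩ := hB
    have fAB : Finite (A ⊕ₗ B) := inferInstanceAs (Finite (A ⊕ B))
    have posA := ncard_simplexFaceSets_pos (filterVectors_finite (P := A))
    have posB := ncard_simplexFaceSets_pos (filterVectors_finite (P := B))
    rw [ncard_simplexFaceSets_eq filterVectors_finite 0,
      ncard_simplexFaceSets_eq antichainVectors_finite 0] at leA ltA
    rw [ncard_simplexFaceSets_eq filterVectors_finite 1,
      ncard_simplexFaceSets_eq antichainVectors_finite 0] at leB ltB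
    rw [ncard_simplexFaceSets_eq filterVectors_finite 0] at posA
    rw [ncard_simplexFaceSets_eq filterVectors_finite 1] at posB
    have key := wedge_count_le_and_lt leA
      (ncard_through_antichainVectors_le.trans ncard_chains_le_through)
      (ncard_through_le_avoiding filterVectors_finite 0) leB
      (ncard_through_antichainVectors_le.trans ncard_chains_le_through_one)
      (ncard_through_le_avoiding filterVectors_finite 1) posA posB
    rw [ncard_simplexFaceSets_filterVectors_lex, ncard_simplexFaceSets_antichainVectors_lex]
    refine ⟨fAB, key.1, fun h => key.2 ?_⟩
    rcases h.of_ordinalSum with h | h | ⟨a, b, c, d, e, hab, hba, hcd, hce, hde, hed⟩ |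
      ⟨a, b, c, d, e, hab, hba, hac, hbc, hde, hed⟩
    · exact Or.inl (ltA h)
    · exact Or.inr (Or.inl (ltB h))
    · exact Or.inr (Or.inr (Or.inl ⟨ncard_through_lt_avoiding_antichainVectors hab hba,
        ncard_through_antichainVectors_le.trans_lt
          (ncard_chains_lt_through_one hde hed hcd hce)⟩))
    · exact Or.inr (Or.inr (Or.inr ⟨ncard_through_antichainVectors_le.trans_lt
        (ncard_chains_lt_through hab hba hac hbc),
        ncard_through_lt_avoiding_antichainVectors hde hed⟩))
  | orderIso A B e _ hA =>
    obtain ⟨fA, leA, ltA⟩ := hA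
    rw [← ncard_simplexFaceSets_image (reindexEquiv e.toEquiv) (filterVectors A),
      ← ncard_simplexFaceSets_image (reindexEquiv e.toEquiv) (antichainVectors A),
      reindexEquiv_image_filterVectors, reindexEquiv_image_antichainVectors] at leA ltA
    refine ⟨Finite.of_equiv A e.toEquiv, leA, fun h => ltA ?_⟩
    rw [← not_xFree_iff] at h ⊢
    exact fun hA => h (hA.of_orderEmbedding e.symm.toOrderEmbedding)

theorem corollary4p2 (P : Type u) [PartialOrder P] [Finite P] (hP : InFamilyF P) :
    simplexPoly (orderPolytope P) = simplexPoly (chainPolytope P) ↔ XFree P := by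
  refine ⟨fun h => ?_, XFree.simplexPoly_eq⟩
  by_contra hX
  have hlt := hP.ncard_simplexFaceSets_le.2.2 (not_xFree_iff.1 hX)
  have heval := congrArg (Polynomial.eval 1) h
  rw [eval_one_simplexPoly_orderPolytope, eval_one_simplexPoly_chainPolytope] at heval
  exact hlt.ne (by simpa using heval)
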